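/- Let $\mathcal H$ be a complex reproducing kernel Hilbert space of functions on a set $X$, and for $w\in X$ let $k_w\in\mathcal H$ be the reproducing kernel at $w$, so that $f(w)=\langle f,k_w\rangle$ for all $f\in\mathcal H$. Let $\mathrm{Gr}(\mathcal H)$ be the Grassmann manifold of closed subspaces of $\mathcal H$, identified with the set of orthogonal projections in $\mathcal B(\mathcal H)$. It carries the linear connection $\frac{DY}{dt}=E_{\gamma(t)}(\dot Y(t))$ for tangent fields $Y$ along a curve $\gamma$ in $\mathrm{Gr}(\mathcal H)$, where $E_P(A)=PA(1-P)+(1-P)AP$. A geodesic joining $\mathcal S$ and $\mathcal T$ is a smooth curve $\gamma:[0,1]\to\mathrm{Gr}(\mathcal H)$ with $\gamma(0)=\mathcal S$, $\gamma(1)=\mathcal T$ and $\frac{D\dot\gamma}{dt}=0$. It is minimal if its length $\int_0^1\|\dot\gamma(t)\|\,dt$ (operator norm) is at most the length of every piecewise smooth curve in $\mathrm{Gr}(\mathcal H)$ joining $\mathcal S$ and $\mathcal T$. Let $\mathbf a=\{a_1,\dots,a_m\}$ and $\mathbf b=\{b_1,\dots,b_k\}$ be disjoint finite subsets of $X$ with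 $m$ and $k$ distinct points, respectively, such that $k_{a_1},\dots,k_{a_m}$ are linearly independent and $k_{b_1},\dots,k_{b_k}$ are linearly independent. Let $\mathcal Z_{\mathbf a}=\{f\in\mathcal H: f(a_j)=0,\ j=1,\dots,m\}$, and similarly $\mathcal Z_{\mathbf b}$. Then: i) There exists a geodesic of $\mathrm{Gr}(\mathcal H)$ joining $\mathcal Z_{\mathbf a}$ and $\mathcal Z_{\mathbf b}$ if and only if $m=k$. There exists a minimal geodesic joining them if and only if $m=k$. ii) If $m=k$, there is a unique minimal geodesic joining $\mathcal Z_{\mathbf a}$ and $\mathcal Z_{\mathbf b}$ if and only if $\det\big((k_{b_i}(a_j))_{1\le i,j\le k}\big)\neq 0$. If this determinant is $0$, there are infinitely many minimal geodesics joining them. -/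

import Mathlib

open scoped ContDiff

noncomputable section

namespace Grassmann

section Curves

variable {H : Type*} [NormedAddCommGroup H] [InnerProductSpace ℂ H] [CompleteSpace H]

variable (H) in
/-- The Grassmann manifold of `H`: the closed subspaces of `H`, presented as the orthogonal
projections onto them (the self-adjoint idempotents of the algebra of bounded operators). -/
abbrev Gr : Type _ := {P : H →L[ℂ] H // IsStarProjection P}

/-- A closed subspace as a point of the Grassmann manifold: its orthogonal projection. -/
def ofSubspace (S : Submodule ℂ H) (hS : IsClosed (S : Set H)) : Gr H :=
  haveI : CompleteSpace S := hS.completeSpace_coe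
  ⟨S.starProjection, isStarProjection_starProjection⟩

/-- A curve `[0,1] → Gr H` seen as an operator-valued function; it is extended to `ℝ` by constants,
and only its values and its one- or two-sided derivatives within `[0,1]` are used. -/
def opCurve (γ : unitInterval → Gr H) : ℝ → (H →L[ℂ] H) :=
  Set.IccExtend zero_le_one (fun t : unitInterval => (γ t : H →L[ℂ] H))

/-- The velocity `γ'(t)`, `t ∈ [0,1]`, in the operator norm topology. -/
def velocity (γ : unitInterval → Gr H) (t : ℝ) : H →L[ℂ] H :=
  derivWithin (opCurve γ) (Set.Icc 0 1) t

/-- The length `∫₀¹ ‖γ'(t)‖ dt` for the Finsler metric given by the operator norm. -/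
def length (γ : unitInterval → Gr H) : ℝ :=
  ∫ t in (0 : ℝ)..1, ‖velocity γ t‖

/-- The curve is smooth on `[0,1]`. -/
def IsSmooth (γ : unitInterval → Gr H) : Prop :=
  ContDiffOn ℝ ∞ (opCurve γ) (Set.Icc 0 1)

/-- The curve is continuous, and smooth on every interval of some finite subdivision
`0 = τ 0 ≤ τ 1 ≤ ⋯ ≤ τ n = 1`. -/
def IsPiecewiseSmooth (γ : unitInterval → Gr H) : Prop :=
  Continuous γ ∧ ∃ (n : ℕ) (τ : ℕ → ℝ), Monotone τ ∧ τ 0 = 0 ∧ τ n = 1 ∧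
    ∀ i < n, ContDiffOn ℝ ∞ (opCurve γ) (Set.Icc (τ i) (τ (i + 1)))

/-- The projection `E_P(X) = P X (1 - P) + (1 - P) X P` onto the tangent space at `P`, i.e. onto
the operators that are co-diagonal with respect to `P`. -/
def tangentProj (P X : H →L[ℂ] H) : H →L[ℂ] H :=
  P * X * (1 - P) + (1 - P) * X * P

/-- The covariant derivative `DX/dt = E_{γ(t)}(X'(t))` of a tangent field `X` along `γ`. -/
def covariantDeriv (γ : unitInterval → Gr H) (X : ℝ → (H →L[ℂ] H)) (t : ℝ) : H →L[ℂ] H :=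
  tangentProj (opCurve γ t) (derivWithin X (Set.Icc 0 1) t)

/-- `γ : [0,1] → Gr H` is a geodesic of the linear connection: it is smooth and its velocity is
parallel along it. -/
def IsGeodesic (γ : unitInterval → Gr H) : Prop :=
  IsSmooth γ ∧ ∀ t ∈ Set.Icc (0 : ℝ) 1, covariantDeriv γ (velocity γ) t = 0

/-- `γ` joins the points `P` and `Q`. -/
def Joins (γ : unitInterval → Gr H) (P Q : Gr H) : Prop :=
  γ 0 = P ∧ γ 1 = Q

/-- `γ` is a minimal geodesic joining `P` and `Q`: a geodesic joining them which is not longer than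
any piecewise smooth curve joining them. -/
def IsMinimalGeodesic (γ : unitInterval → Gr H) (P Q : Gr H) : Prop :=
  IsGeodesic γ ∧ Joins γ P Q ∧
    ∀ σ : unitInterval → Gr H, IsPiecewiseSmooth σ → Joins σ P Q → length γ ≤ length σ

end Curves

section ZeroSets

variable {X : Type*} (H : Type*) [NormedAddCommGroup H] [InnerProductSpace ℂ H] [RKHS ℂ H X ℂ]

/-- The functions of `H` that vanish on the set `s`. -/
def zeroSubspace (s : Set X) : Submodule ℂ H where
  carrier := {f | ∀ x ∈ s, f x = 0}
  add_mem' := by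
    intro f g hf hg x hx
    simp [hf x hx, hg x hx]
  zero_mem' := by
    intro x _
    simp
  smul_mem' := by
    intro c f hf x hx
    simp [hf x hx]

theorem isClosed_zeroSubspace (s : Set X) : IsClosed (zeroSubspace H s : Set H) := by
  have h : (zeroSubspace H s : Set H) = ⋂ x ∈ s, {f : H | f x = 0} := by
    ext f
    simp [zeroSubspace]
  rw [h]
  exact isClosed_biInter fun x _ => isClosed_eq (RKHS.continuous_eval x) continuous_const

variable [CompleteSpace H]

/-- The subspace of the functions vanishing on `s`, as a point of the Grassmann manifold of `H`. -/
def Z (s : Set X) : Gr H :=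
  ofSubspace (zeroSubspace H s) (isClosed_zeroSubspace H s)

/-- The reproducing kernel `k_w ∈ H` of the point `w`: `f w = ⟨f, k_w⟩`, linear in `f`. -/
def ker (w : X) : H := RKHS.kerFun H w (1 : ℂ)

/-- The reproducing property (Mathlib's inner product is linear in its second argument). -/
theorem inner_ker (w : X) (f : H) : inner ℂ (ker H w) f = f w := by
  simp [ker]

end ZeroSets

end Grassmann

end

/-!
Replace a projection `P` by its symmetry `S = 2 P - 1`, a self-adjoint unitary. The tangent
projection at `P` kills exactly the operators that commute with `S`. So along a geodesic `S''`
commutes with `S`, and differentiating `S ^ 2 = 1` twice gives `(S' S)' = 0`: the geodesics issuing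
from `P` are the curves with `S(t) = exp (t B) S(0)`, where `B` is skew-adjoint and anticommutes
with `S(0)`, and the length of such a curve is `‖B‖ / 2` (`IsGeodesic.exists_generator`,
`IsGenerator.length_geodesic`).

For a unit vector `x` the curve `S(t) x` lies on the unit sphere of `H` and has speed at most
`2 ‖P'(t)‖`. Comparing with the angle between its endpoints shows that every piecewise smooth curve
from `P` to `Q` has length at least `arcsin ‖Q - P‖` (`arcsin_norm_sub_le_length`).

If `‖Q - P‖ < 1`, then `exp B = (2 Q - 1) (2 P - 1)` has exactly one skew-adjoint solution of norm
less than `π`, the principal logarithm; it anticommutes with `2 P - 1` and attains the lower bound,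
so there is exactly one minimal geodesic (`existsUnique_isMinimalGeodesic`).

In general, let `P` and `Q` have kernels of the same finite dimension. Then `ker P ⊓ range Q` and
`ker Q ⊓ range P` have the same dimension, and a partial isometry `V` from the first onto the second
allows one to exchange them: the exchanged projection `Q'` satisfies `‖Q' - P‖ < 1`. If `C` is the
logarithm for `Q'`, then `C + π (z V - z̄ V⋆)` joins `P` to `Q` for every `z` on the unit circle, and
its norm is at most `π`. If the two subspaces are not zero, then `‖Q - P‖ = 1`, all these geodesics
have the minimal length `π / 2`, and there are infinitely many of them
(`infinite_isMinimalGeodesic`).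

Finally, the kernel of the projection onto the functions vanishing at the points `a` is the span of
the reproducing kernels at these points. Its dimension cannot change along a continuous curve of
projections (`rank_ker_eq_of_joins`), which forces `m = k`; and the determinant vanishes exactly
when some nonzero combination of the kernels at `b` vanishes at all points of `a`, that is, when
`ker Q ⊓ range P ≠ 0` (`kerInfRange_Z_eq_bot_iff`).
-/

noncomputable section

namespace Grassmann

open Set Filter Topology NormedSpace

section Symmetry

variable {H : Type*} [NormedAddCommGroup H] [InnerProductSpace ℂ H]

/-! ### The symmetry of a projection -/

/-- The symmetry `2 P - 1` attached to a projection `P`: it is `1` on the range of `P` and `-1` on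
its kernel. -/
def symmetry (P : H →L[ℂ] H) : H →L[ℂ] H := 2 * P - 1

theorem symmetry_injective : Function.Injective (symmetry : (H →L[ℂ] H) → _) := by
  intro P Q h
  have h2 : (2 : ℂ) • P = (2 : ℂ) • Q := by
    simpa [symmetry, two_mul, two_smul] using h
  exact smul_right_injective _ (two_ne_zero) h2

theorem norm_symmetry_sub (P Q : H →L[ℂ] H) : ‖symmetry Q - symmetry P‖ = 2 * ‖Q - P‖ := by
  have : symmetry Q - symmetry P = (2 : ℂ) • (Q - P) := by
    rw [two_smul]; unfold symmetry; noncomm_ring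
  rw [this, norm_smul]; simp

theorem symmetry_half_one_add (w : H →L[ℂ] H) : symmetry ((2⁻¹ : ℝ) • (1 + w)) = w := by
  have : 2 * ((2⁻¹ : ℝ) • (1 + w)) = 1 + w := by
    rw [mul_smul_comm, two_mul, ← two_smul ℝ, smul_smul]; norm_num
  rw [symmetry, this]; abel

theorem two_mul_tangentProj (P Y : H →L[ℂ] H) :
    2 * tangentProj P Y = Y - symmetry P * Y * symmetry P := by
  unfold tangentProj symmetry; noncomm_ring

variable [CompleteSpace H]

theorem symmetry_mul_self {P : H →L[ℂ] H} (hP : IsStarProjection P) :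
    symmetry P * symmetry P = 1 := by
  have h : P * P = P := hP.isIdempotentElem
  have : symmetry P * symmetry P = 4 * (P * P) - 4 * P + 1 := by
    unfold symmetry; noncomm_ring
  rw [this, h]; noncomm_ring

theorem star_symmetry {P : H →L[ℂ] H} (hP : IsStarProjection P) :
    star (symmetry P) = symmetry P := by
  have h : star P = P := hP.isSelfAdjoint
  simp [symmetry, h, two_mul]

theorem symmetry_mem_unitary {P : H →L[ℂ] H} (hP : IsStarProjection P) :
    symmetry P ∈ unitary (H →L[ℂ] H) := by
  rw [Unitary.mem_iff, star_symmetry hP, symmetry_mul_self hP]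
  exact ⟨rfl, rfl⟩

theorem isStarProjection_half_one_add {w : H →L[ℂ] H} (h1 : w * w = 1) (h2 : star w = w) :
    IsStarProjection ((2⁻¹ : ℝ) • (1 + w)) := by
  constructor
  · have : (1 + w) * (1 + w) = (2 : ℝ) • (1 + w) := by
      rw [mul_add, add_mul, add_mul, h1, two_smul]; simp; abel
    rw [IsIdempotentElem, smul_mul_smul_comm, this, smul_smul]; norm_num
  · rw [IsSelfAdjoint, star_smul, star_add, h2]; simp

theorem norm_symmetry_apply {P : H →L[ℂ] H} (hP : IsStarProjection P) (x : H) :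
    ‖symmetry P x‖ = ‖x‖ :=
  ContinuousLinearMap.norm_map_of_mem_unitary (symmetry_mem_unitary hP) x

/-- The tangent projection kills exactly the operators that commute with the symmetry. -/
theorem tangentProj_eq_zero_iff {P : H →L[ℂ] H} (hP : IsStarProjection P) (Y : H →L[ℂ] H) :
    tangentProj P Y = 0 ↔ Y * symmetry P = symmetry P * Y := by
  have h2 : (2 * tangentProj P Y = 0) ↔ tangentProj P Y = 0 := by
    rw [two_mul, ← two_smul ℂ, smul_eq_zero]; simp
  have hs := symmetry_mul_self hP
  rw [← h2, two_mul_tangentProj, sub_eq_zero]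
  constructor
  · intro h
    calc Y * symmetry P = symmetry P * Y * (symmetry P * symmetry P) := by
          conv_lhs => rw [h]
          simp only [mul_assoc]
      _ = _ := by rw [hs, mul_one]
  · intro h
    rw [← h, mul_assoc, hs, mul_one]

/-! ### The one-parameter families `exp (t B) (2 P - 1)` -/

/-- The operators `B` that are skew-adjoint and codiagonal with respect to `P`. -/
structure IsGenerator (P B : H →L[ℂ] H) : Prop where
  star_eq : star B = -B
  anticomm : B * symmetry P = -(symmetry P * B)

/-- The curve of projections with symmetries `exp (t B) (2 P - 1)`. -/
def expCurve (P B : H →L[ℂ] H) (t : ℝ) : H →L[ℂ] H :=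
  (2⁻¹ : ℝ) • (1 + exp (t • B) * symmetry P)

theorem exp_add_operator {Y Z : H →L[ℂ] H} (h : Commute Y Z) : exp (Y + Z) = exp Y * exp Z :=
  have : NormedAlgebra ℚ (H →L[ℂ] H) := .restrictScalars ℚ ℂ _
  exp_add_of_commute h

theorem exp_mul_exp_neg (Y : H →L[ℂ] H) : exp Y * exp (-Y) = 1 := by
  rw [← exp_add_operator (Commute.refl Y).neg_right, add_neg_cancel, exp_zero]

theorem IsGenerator.symmetry_mul_exp {P B : H →L[ℂ] H} (hB : IsGenerator P B) (t : ℝ) :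
    symmetry P * exp (t • B) = exp (-(t • B)) * symmetry P := by
  have : NormedAlgebra ℚ (H →L[ℂ] H) := .restrictScalars ℚ ℂ _
  have h : SemiconjBy (symmetry P) (t • B) (-(t • B)) := by
    rw [SemiconjBy, neg_mul, smul_mul_assoc, hB.anticomm, mul_smul_comm, smul_neg, neg_neg]
  exact h.exp_right

theorem IsGenerator.star_exp {P B : H →L[ℂ] H} (hB : IsGenerator P B) (t : ℝ) :
    star (exp (t • B)) = exp (-(t • B)) := by
  rw [NormedSpace.star_exp, star_smul, hB.star_eq]; simp

theorem symmetry_expCurve (P B : H →L[ℂ] H) (t : ℝ) :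
    symmetry (expCurve P B t) = exp (t • B) * symmetry P :=
  symmetry_half_one_add _

theorem expCurve_zero (P B : H →L[ℂ] H) : expCurve P B 0 = P := by
  apply symmetry_injective
  rw [symmetry_expCurve, zero_smul, exp_zero, one_mul]

theorem IsGenerator.isStarProjection_expCurve {P B : H →L[ℂ] H} (hP : IsStarProjection P)
    (hB : IsGenerator P B) (t : ℝ) : IsStarProjection (expCurve P B t) := by
  apply isStarProjection_half_one_add
  · rw [mul_assoc, ← mul_assoc (symmetry P), hB.symmetry_mul_exp, mul_assoc, symmetry_mul_self hP,
      mul_one, exp_mul_exp_neg]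
  · rw [star_mul, star_symmetry hP, hB.star_exp, ← neg_smul, hB.symmetry_mul_exp, neg_smul, neg_neg]

/-- The geodesic with initial point `P` and generator `B`. -/
def IsGenerator.geodesic {P : Gr H} {B : H →L[ℂ] H} (hB : IsGenerator (P : H →L[ℂ] H) B) :
    unitInterval → Gr H :=
  fun t => ⟨expCurve P B t, hB.isStarProjection_expCurve P.2 t⟩

theorem opCurve_of_mem (γ : unitInterval → Gr H) {t : ℝ} (ht : t ∈ Icc (0 : ℝ) 1) :
    opCurve γ t = γ ⟨t, ht⟩ :=
  IccExtend_of_mem _ _ ht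

theorem IsGenerator.opCurve_geodesic {P : Gr H} {B : H →L[ℂ] H}
    (hB : IsGenerator (P : H →L[ℂ] H) B) : EqOn (opCurve hB.geodesic) (expCurve P B) (Icc 0 1) :=
  fun _ ht => opCurve_of_mem _ ht

theorem hasDerivAt_exp_smul_mul (B S : H →L[ℂ] H) (t : ℝ) :
    HasDerivAt (fun s : ℝ => exp (s • B) * S) (B * (exp (t • B) * S)) t := by
  rw [← mul_assoc]
  exact (hasDerivAt_exp_smul_const' B t).mul_const S

theorem hasDerivAt_expCurve (P B : H →L[ℂ] H) (t : ℝ) :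
    HasDerivAt (expCurve P B) ((2⁻¹ : ℝ) • (B * (exp (t • B) * symmetry P))) t :=
  ((hasDerivAt_exp_smul_mul B (symmetry P) t).const_add 1).const_smul (2⁻¹ : ℝ)

theorem IsGenerator.velocity_geodesic {P : Gr H} {B : H →L[ℂ] H}
    (hB : IsGenerator (P : H →L[ℂ] H) B) {t : ℝ} (ht : t ∈ Icc (0 : ℝ) 1) :
    velocity hB.geodesic t = (2⁻¹ : ℝ) • (B * (exp (t • B) * symmetry P)) := by
  rw [velocity, derivWithin_congr hB.opCurve_geodesic (hB.opCurve_geodesic ht)]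
  exact (hasDerivAt_expCurve _ B t).hasDerivWithinAt.derivWithin
    (uniqueDiffOn_Icc zero_lt_one t ht)

theorem IsGenerator.norm_velocity_geodesic {P : Gr H} {B : H →L[ℂ] H}
    (hB : IsGenerator (P : H →L[ℂ] H) B) {t : ℝ} (ht : t ∈ Icc (0 : ℝ) 1) :
    ‖velocity hB.geodesic t‖ = ‖B‖ / 2 := by
  have h : ‖B * symmetry (expCurve (P : H →L[ℂ] H) B t)‖ = ‖B‖ :=
    CStarRing.norm_mul_mem_unitary B (symmetry_mem_unitary (hB.isStarProjection_expCurve P.2 t))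
  have h2 : ‖(2⁻¹ : ℝ)‖ = 2⁻¹ := by norm_num
  rw [hB.velocity_geodesic ht, ← symmetry_expCurve, norm_smul, h, h2, div_eq_inv_mul]

theorem IsGenerator.length_geodesic {P : Gr H} {B : H →L[ℂ] H}
    (hB : IsGenerator (P : H →L[ℂ] H) B) : length hB.geodesic = ‖B‖ / 2 := by
  have : length hB.geodesic = ∫ _ in (0 : ℝ)..1, ‖B‖ / 2 := by
    apply intervalIntegral.integral_congr
    intro t ht
    rw [uIcc_of_le zero_le_one] at ht
    exact hB.norm_velocity_geodesic ht
  simp [this]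

theorem IsGenerator.isGeodesic_geodesic {P : Gr H} {B : H →L[ℂ] H}
    (hB : IsGenerator (P : H →L[ℂ] H) B) : IsGeodesic hB.geodesic := by
  constructor
  · refine ContDiffOn.congr (ContDiff.contDiffOn ?_) hB.opCurve_geodesic
    have h1 : ContDiff ℝ ∞ (exp : (H →L[ℂ] H) → H →L[ℂ] H) :=
      contDiff_iff_contDiffAt.2 fun x => (exp_analytic (𝕂 := ℝ) x).contDiffAt
    have h2 : ContDiff ℝ ∞ fun t : ℝ => exp (t • B) := h1.comp (contDiff_id.smul contDiff_const)
    exact (contDiff_const.add (h2.mul contDiff_const)).const_smul _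
  · intro t ht
    have hs := symmetry_expCurve (P : H →L[ℂ] H) B t
    have hd : derivWithin (velocity hB.geodesic) (Icc 0 1) t
        = (2⁻¹ : ℝ) • (B * (B * symmetry (expCurve (P : H →L[ℂ] H) B t))) := by
      rw [derivWithin_congr (fun s hs => hB.velocity_geodesic hs) (hB.velocity_geodesic ht), hs]
      exact (((hasDerivAt_exp_smul_mul B (symmetry (P : H →L[ℂ] H)) t).const_mul
        B).const_smul (2⁻¹ : ℝ)).hasDerivWithinAt.derivWithin (uniqueDiffOn_Icc zero_lt_one t ht)
    have hanti : B * symmetry (expCurve (P : H →L[ℂ] H) B t)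
        = -(symmetry (expCurve (P : H →L[ℂ] H) B t) * B) := by
      have hc : Commute B (exp (t • B)) := ((Commute.refl B).smul_right t).exp_right
      rw [hs, ← mul_assoc, hc.eq, mul_assoc, hB.anticomm, mul_neg, mul_assoc]
    rw [covariantDeriv, hB.opCurve_geodesic ht,
      tangentProj_eq_zero_iff (hB.isStarProjection_expCurve P.2 t), hd]
    set S := symmetry (expCurve (P : H →L[ℂ] H) B t)
    have : B * (B * S) = S * (B * B) := by
      rw [hanti, mul_neg, ← mul_assoc, hanti, neg_mul, neg_neg, mul_assoc]
    rw [smul_mul_assoc, mul_smul_comm, this, mul_assoc, ← this, mul_assoc]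

theorem IsGenerator.joins_geodesic {P Q : Gr H} {B : H →L[ℂ] H}
    (hB : IsGenerator (P : H →L[ℂ] H) B)
    (h : exp B * symmetry (P : H →L[ℂ] H) = symmetry (Q : H →L[ℂ] H)) :
    Joins hB.geodesic P Q := by
  constructor
  · exact Subtype.ext (expCurve_zero _ _)
  · apply Subtype.ext
    apply symmetry_injective
    change symmetry (expCurve (P : H →L[ℂ] H) B 1) = _
    rw [symmetry_expCurve, one_smul, h]

theorem IsGenerator.exp_mul_symmetry_of_joins {P Q : Gr H} {B : H →L[ℂ] H}
    (hB : IsGenerator (P : H →L[ℂ] H) B) (h : Joins hB.geodesic P Q) :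
    exp B * symmetry (P : H →L[ℂ] H) = symmetry (Q : H →L[ℂ] H) := by
  rw [← h.2]
  change _ = symmetry (expCurve (P : H →L[ℂ] H) B 1)
  rw [symmetry_expCurve, one_smul]

end Symmetry

section Classification

variable {H : Type*} [NormedAddCommGroup H] [InnerProductSpace ℂ H]

/-! ### Every geodesic is one of these families -/

theorem HasDerivWithinAt.symmetry {c : ℝ → H →L[ℂ] H} {c' : H →L[ℂ] H} {s : Set ℝ} {t : ℝ}
    (h : HasDerivWithinAt c c' s t) :
    HasDerivWithinAt (fun t => symmetry (c t)) (2 * c') s t :=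
  (h.const_mul 2).sub_const 1

theorem hasDerivWithinAt_eq_zero_of_const {f : ℝ → H →L[ℂ] H} {f' C : H →L[ℂ] H} {t : ℝ}
    (ht : t ∈ Icc (0 : ℝ) 1) (h : HasDerivWithinAt f f' (Icc 0 1) t)
    (hC : ∀ s ∈ Icc (0 : ℝ) 1, f s = C) : f' = 0 :=
  (uniqueDiffOn_Icc zero_lt_one t ht).eq_deriv _ h
    ((hasDerivWithinAt_const t _ C).congr hC (hC t ht))

variable [CompleteSpace H]

theorem isStarProjection_opCurve (γ : unitInterval → Gr H) (t : ℝ) :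
    IsStarProjection (opCurve γ t) := by
  unfold opCurve IccExtend
  exact (γ _).2

/-- For a geodesic with symmetries `S = 2 γ - 1`, differentiating `S ^ 2 = 1` twice and using that
`S''` commutes with `S` shows that `B = S' S` is constant, so that `S' = B S`. -/
theorem IsGeodesic.exists_generator {γ : unitInterval → Gr H} {P : Gr H} (hγ : IsGeodesic γ)
    (h0 : γ 0 = P) :
    ∃ (B : H →L[ℂ] H) (hB : IsGenerator (P : H →L[ℂ] H) B), γ = hB.geodesic := by
  obtain ⟨hs, hpar⟩ := hγ
  have hu : UniqueDiffOn ℝ (Icc (0 : ℝ) 1) := uniqueDiffOn_Icc zero_lt_one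
  set v := velocity γ with hv_def
  set w := fun t => derivWithin v (Icc 0 1) t with hw_def
  set S : ℝ → H →L[ℂ] H := fun t => symmetry (opCurve γ t) with hS_def
  have hSS : ∀ t, S t * S t = 1 := fun t => symmetry_mul_self (isStarProjection_opCurve γ t)
  have hS : ∀ t ∈ Icc (0 : ℝ) 1, HasDerivWithinAt S (2 * v t) (Icc 0 1) t := fun t ht =>
    HasDerivWithinAt.symmetry ((hs.differentiableOn (by simp)) t ht).hasDerivWithinAt
  have hv : ∀ t ∈ Icc (0 : ℝ) 1, HasDerivWithinAt v (w t) (Icc 0 1) t := fun t ht =>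
    ((hs.derivWithin hu (m := 1) (by norm_cast)).differentiableOn (by simp) t ht).hasDerivWithinAt
  have hanti : ∀ t ∈ Icc (0 : ℝ) 1, v t * S t + S t * v t = 0 := by
    intro t ht
    have h := hasDerivWithinAt_eq_zero_of_const ht ((hS t ht).mul (hS t ht)) (fun s _ => hSS s)
    have h2 : (2 : ℂ) • (v t * S t + S t * v t) = 0 := by
      rw [← h, two_smul]; noncomm_ring
    exact (smul_eq_zero.1 h2).resolve_left two_ne_zero
  have hcomm : ∀ t ∈ Icc (0 : ℝ) 1, w t * S t = S t * w t := fun t ht =>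
    (tangentProj_eq_zero_iff (isStarProjection_opCurve γ t) _).1 (hpar t ht)
  have hsecond : ∀ t ∈ Icc (0 : ℝ) 1, w t * S t + v t * (2 * v t) = 0 := by
    intro t ht
    have h := hasDerivWithinAt_eq_zero_of_const ht
      (((hv t ht).mul (hS t ht)).add ((hS t ht).mul (hv t ht))) hanti
    have h2 : (2 : ℂ) • (w t * S t + v t * (2 * v t)) = 0 := by
      rw [← h, ← hcomm t ht, two_smul]; noncomm_ring
    exact (smul_eq_zero.1 h2).resolve_left two_ne_zero
  have hB : ∀ t ∈ Icc (0 : ℝ) 1, 2 * (v t * S t) = 2 * (v 0 * S 0) := by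
    have hd : ∀ t ∈ Icc (0 : ℝ) 1,
        HasDerivWithinAt (fun t => 2 * (v t * S t)) 0 (Icc 0 1) t := by
      intro t ht
      have := ((hv t ht).mul (hS t ht)).const_mul (2 : H →L[ℂ] H)
      rwa [hsecond t ht, mul_zero] at this
    exact constant_of_derivWithin_zero (fun t ht => (hd t ht).differentiableWithinAt)
      fun t ht => (hd t (Ico_subset_Icc_self ht)).derivWithin (hu t (Ico_subset_Icc_self ht))
  set B := 2 * (v 0 * S 0) with hB_def
  have h0I : (0 : ℝ) ∈ Icc (0 : ℝ) 1 := ⟨le_rfl, zero_le_one⟩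
  have hBS : ∀ t ∈ Icc (0 : ℝ) 1, B * S t = 2 * v t := by
    intro t ht
    rw [← hB t ht, mul_assoc, mul_assoc, hSS, mul_one]
  have hP0 : S 0 = symmetry (P : H →L[ℂ] H) := by
    rw [hS_def]
    simp only [opCurve_of_mem γ h0I]
    rw [← h0]; rfl
  have hvstar : star (v 0) = v 0 := by
    have h1 := ((hs.differentiableOn (by simp)) 0 h0I).hasDerivWithinAt
    have h2 := h1.star
    refine (hu 0 h0I).eq_deriv _ (h2.congr ?_ ?_) h1
    · intro t _
      exact ((isStarProjection_opCurve γ t).isSelfAdjoint).symm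
    · exact ((isStarProjection_opCurve γ 0).isSelfAdjoint).symm
  have hSstar : star (S 0) = S 0 := star_symmetry (isStarProjection_opCurve γ 0)
  have hvS : v 0 * S 0 = -(S 0 * v 0) := eq_neg_of_add_eq_zero_left (hanti 0 h0I)
  have hgen : IsGenerator (P : H →L[ℂ] H) B := by
    constructor
    · rw [hB_def, two_mul, star_add, star_mul, hvstar, hSstar, hvS]; abel
    · rw [← hP0, hB_def]
      conv_lhs => rw [hvS]
      noncomm_ring
  refine ⟨B, hgen, ?_⟩
  have hconst : ∀ t ∈ Icc (0 : ℝ) 1, exp (t • (-B)) * S t = S 0 := by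
    have hd : ∀ t ∈ Icc (0 : ℝ) 1,
        HasDerivWithinAt (fun t : ℝ => exp (t • (-B)) * S t) 0 (Icc 0 1) t := by
      intro t ht
      have := ((hasDerivAt_exp_smul_const (-B) t).hasDerivWithinAt (s := Icc 0 1)).mul (hS t ht)
      have h0 : exp (t • (-B)) * (-B) * S t + exp (t • (-B)) * (2 * v t) = 0 := by
        rw [← hBS t ht]; noncomm_ring
      rwa [h0] at this
    intro t ht
    have := constant_of_derivWithin_zero (fun t ht => (hd t ht).differentiableWithinAt)
      (fun t ht => (hd t (Ico_subset_Icc_self ht)).derivWithin (hu t (Ico_subset_Icc_self ht))) t ht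
    rw [this]; simp
  funext t
  apply Subtype.ext
  apply symmetry_injective
  have ht := hconst t t.2
  change _ = symmetry (expCurve (P : H →L[ℂ] H) B t)
  have hSt : S t = symmetry (γ t : H →L[ℂ] H) := by
    simp only [hS_def, opCurve_of_mem γ t.2]
  rw [symmetry_expCurve, ← hP0, ← ht, ← hSt, ← mul_assoc, smul_neg, exp_mul_exp_neg, one_mul]

end Classification

section LowerBound

/-! ### The length of a curve on the unit sphere -/

section Sphere

open InnerProductGeometry

variable {V : Type*} [NormedAddCommGroup V] [InnerProductSpace ℝ V]

theorem angle_eq_two_mul_arcsin {x y : V} (hx : ‖x‖ = 1) (hy : ‖y‖ = 1) :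
    angle x y = 2 * Real.arcsin (‖y - x‖ / 2) := by
  have h1 : ‖y - x‖ ^ 2 = 2 - 2 * Real.cos (angle x y) := by
    rw [← inner_eq_cos_angle_of_norm_eq_one hx hy, norm_sub_sq_real, hx, hy, real_inner_comm]
    ring
  have h2 : Real.cos (angle x y) = 1 - 2 * Real.sin (angle x y / 2) ^ 2 := by
    have := Real.cos_sq' (angle x y / 2)
    have h3 := Real.cos_two_mul (angle x y / 2)
    rw [mul_div_cancel₀ _ two_ne_zero] at h3
    rw [h3, this]; ring
  have hs : 0 ≤ Real.sin (angle x y / 2) :=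
    Real.sin_nonneg_of_nonneg_of_le_pi (by linarith [angle_nonneg x y])
      (by linarith [angle_le_pi x y, Real.pi_pos])
  have h4 : Real.sin (angle x y / 2) = ‖y - x‖ / 2 := by
    have : Real.sin (angle x y / 2) ^ 2 = (‖y - x‖ / 2) ^ 2 := by
      rw [div_pow, h1, h2]; ring
    exact (pow_left_inj₀ hs (by positivity) two_ne_zero).1 this
  rw [Real.arcsin_eq_of_sin_eq h4 ⟨by linarith [angle_nonneg x y, Real.pi_pos],
    by linarith [angle_le_pi x y]⟩]
  ring

/-- A curve on the unit sphere is at least as long as the angle between its endpoints: by the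
triangle inequality for angles, the angle to the initial point has upper right derivative at most
the speed. -/
theorem angle_le_integral {u u' : ℝ → V} {n : ℝ → ℝ} {a b : ℝ} (hab : a ≤ b)
    (hu : ∀ t ∈ Icc a b, ‖u t‖ = 1)
    (hd : ∀ t ∈ Icc a b, HasDerivWithinAt u (u' t) (Icc a b) t)
    (hn : ContinuousOn n (Icc a b)) (hle : ∀ t ∈ Icc a b, ‖u' t‖ ≤ n t) :
    angle (u a) (u b) ≤ ∫ t in a..b, n t := by
  have haI : a ∈ Icc a b := left_mem_Icc.2 hab
  set N : ℝ → ℝ := IccExtend hab ((Icc a b).domRestrict n) with hN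
  have hNc : Continuous N := (continuousOn_iff_continuous_domRestrict.1 hn).Icc_extend'
  have hNn : ∀ t ∈ Icc a b, N t = n t := fun t ht => IccExtend_of_mem hab _ ht
  have hint : ∫ t in a..b, n t = ∫ t in a..b, N t :=
    intervalIntegral.integral_congr fun t ht => (hNn t (by rwa [uIcc_of_le hab] at ht)).symm
  have hBd : ∀ x, HasDerivAt (fun x => ∫ t in a..x, N t) (N x) x := fun x =>
    (hNc.integral_hasStrictDerivAt a x).hasDerivAt
  have hucont : ContinuousOn u (Icc a b) := fun t ht => (hd t ht).continuousWithinAt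
  have hangle : ∀ t ∈ Icc a b, ∀ s ∈ Icc a b,
      angle (u t) (u s) = 2 * Real.arcsin (‖u s - u t‖ / 2) := fun t ht s hs =>
    angle_eq_two_mul_arcsin (hu t ht) (hu s hs)
  rw [hint]
  refine image_le_of_liminf_slope_right_le_deriv_boundary (f := fun t => angle (u a) (u t))
    (B := fun x => ∫ t in a..x, N t) (B' := N) ?_ ?_ ?_ ?_ ?_ (right_mem_Icc.2 hab)
  · refine ContinuousOn.congr (f := fun t => 2 * Real.arcsin (‖u t - u a‖ / 2)) ?_
      fun t ht => hangle a haI t ht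
    exact continuousOn_const.mul
      (Real.continuous_arcsin.comp_continuousOn ((hucont.sub continuousOn_const).norm.div_const 2))
  · have : u a ≠ 0 := by
      intro h; have := hu a haI; rw [h] at this; simp at this
    simp [angle_self this]
  · exact fun x _ => (hBd x).continuousAt.continuousWithinAt
  · exact fun x _ => (hBd x).hasDerivWithinAt
  · intro x hx r hr
    apply Eventually.frequently
    have hxI := Ico_subset_Icc_self hx
    -- `g c` is the angle subtended by a chord of length `c`
    set g : ℝ → ℝ := fun c => 2 * Real.arcsin (c / 2) with hg
    have hgd : HasDerivAt g 1 0 := by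
      have h1 : HasDerivAt Real.arcsin 1 ((0 : ℝ) / 2) := by
        have := Real.hasDerivAt_arcsin (x := (0 : ℝ) / 2) (by norm_num) (by norm_num)
        simpa using this
      have h2 := (HasDerivAt.comp (0 : ℝ) h1 ((hasDerivAt_id (0 : ℝ)).div_const 2)).const_mul 2
      simpa [hg, Function.comp_def] using h2
    have hgds : Tendsto (dslope g 0) (𝓝 0) (𝓝 1) := by
      have := continuousAt_dslope_same.2 hgd.differentiableAt
      rwa [ContinuousAt, dslope_same, hgd.deriv] at this
    have hnhds : 𝓝[>] x ≤ 𝓝[Icc a b \ {x}] x :=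
      le_inf inf_le_left <| le_principal_iff.2 <| by
        filter_upwards [Ioc_mem_nhdsGT hx.2] with z hz
        exact ⟨⟨hx.1.trans hz.1.le, hz.2⟩, hz.1.ne'⟩
    have hslope : Tendsto (fun z => ‖slope u x z‖) (𝓝[>] x) (𝓝 ‖u' x‖) :=
      ((hasDerivWithinAt_iff_tendsto_slope.1 (hd x hxI)).mono_left hnhds).norm
    have hchord : Tendsto (fun z => ‖u z - u x‖) (𝓝[>] x) (𝓝 0) := by
      have h1 : Tendsto u (𝓝[>] x) (𝓝 (u x)) :=
        (hd x hxI).continuousWithinAt.tendsto.mono_left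
          (hnhds.trans (nhdsWithin_mono _ sdiff_subset))
      have := (h1.sub_const (u x)).norm
      simpa using this
    have hlim : Tendsto (fun z => ‖slope u x z‖ * dslope g 0 ‖u z - u x‖) (𝓝[>] x)
        (𝓝 (‖u' x‖ * 1)) := hslope.mul (hgds.comp hchord)
    have hlt : ‖u' x‖ * 1 < r := by
      rw [mul_one]; rw [hNn x hxI] at hr; exact (hle x hxI).trans_lt hr
    filter_upwards [hlim.eventually_lt_const hlt, Ioc_mem_nhdsGT hx.2] with z hz hzx
    have hzI : z ∈ Icc a b := ⟨hx.1.trans hzx.1.le, hzx.2⟩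
    have hpos : 0 < z - x := sub_pos.2 hzx.1
    refine lt_of_le_of_lt ?_ hz
    have htri : angle (u a) (u z) - angle (u a) (u x) ≤ g ‖u z - u x‖ := by
      have := angle_le_angle_add_angle (u a) (u x) (u z)
      rw [hangle x hxI z hzI] at this
      linarith
    have hgc : g ‖u z - u x‖ = ‖u z - u x‖ * dslope g 0 ‖u z - u x‖ := by
      have := sub_smul_dslope g 0 ‖u z - u x‖
      have hg0 : g 0 = 0 := by simp [hg]
      rw [hg0] at this
      simpa using this.symm
    have hsl : ‖slope u x z‖ = ‖u z - u x‖ / (z - x) := by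
      rw [slope_def_module, norm_smul, norm_inv, Real.norm_eq_abs, abs_of_pos hpos, div_eq_inv_mul]
    rw [slope_def_field, hsl, div_mul_eq_mul_div, ← hgc]
    gcongr

end Sphere

/-! ### The lower bound for the length -/

variable {H : Type*} [NormedAddCommGroup H] [InnerProductSpace ℂ H] [CompleteSpace H]

attribute [local instance] InnerProductSpace.complexToReal

theorem length_nonneg (σ : unitInterval → Gr H) : 0 ≤ length σ :=
  intervalIntegral.integral_nonneg zero_le_one fun _ _ => norm_nonneg _

/-- Every vector `(2 σ(t) - 1) x` moves on a sphere, with speed at most `2 ‖σ'(t)‖ ‖x‖`. -/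
theorem angle_symmetry_le_two_mul_length {σ : unitInterval → Gr H} (hσ : IsPiecewiseSmooth σ)
    {x : H} (hx : ‖x‖ = 1) :
    InnerProductGeometry.angle (symmetry (opCurve σ 0) x) (symmetry (opCurve σ 1) x)
      ≤ 2 * length σ := by
  obtain ⟨-, n, τ, hτ, hτ0, hτn, hsm⟩ := hσ
  set u : ℝ → H := fun t => symmetry (opCurve σ t) x with hu_def
  have hunit : ∀ t, ‖u t‖ = 1 := fun t => by
    rw [hu_def, norm_symmetry_apply (isStarProjection_opCurve σ t), hx]
  have hne : ∀ t, u t ≠ 0 := fun t h => by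
    have := hunit t; rw [h, norm_zero] at this; exact zero_ne_one this
  have h01 : ∀ i ≤ n, τ i ∈ Icc (0 : ℝ) 1 := fun i hi =>
    ⟨hτ0 ▸ hτ (Nat.zero_le i), hτn ▸ hτ hi⟩
  set D : ℕ → ℝ → H →L[ℂ] H := fun i => derivWithin (opCurve σ) (Icc (τ i) (τ (i + 1)))
  have hDc : ∀ i < n, τ i < τ (i + 1) → ContinuousOn (D i) (Icc (τ i) (τ (i + 1))) :=
    fun i hi hlt => (hsm i hi).continuousOn_derivWithin (uniqueDiffOn_Icc hlt) (by simp)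
  have hDv : ∀ i < n, ∀ t ∈ Ioo (τ i) (τ (i + 1)), ‖D i t‖ = ‖velocity σ t‖ := by
    intro i hi t ht
    have h1 : Icc (τ i) (τ (i + 1)) ∈ 𝓝 t := Icc_mem_nhds ht.1 ht.2
    have h2 : Icc (0 : ℝ) 1 ∈ 𝓝 t :=
      mem_of_superset h1 (Icc_subset_Icc (h01 i hi.le).1 (h01 (i + 1) hi).2)
    simp only [D, velocity, derivWithin_of_mem_nhds h1, derivWithin_of_mem_nhds h2]
  have hae : ∀ i < n, ∀ᵐ t ∂(MeasureTheory.volume.restrict (uIoc (τ i) (τ (i + 1)))),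
      ‖D i t‖ = ‖velocity σ t‖ := by
    intro i hi
    rw [uIoc_of_le (hτ (Nat.le_succ i)), ← MeasureTheory.restrict_Ioo_eq_restrict_Ioc]
    exact (MeasureTheory.ae_restrict_iff' measurableSet_Ioo).2 (.of_forall (hDv i hi))
  have hpiece : ∀ i < n, IntervalIntegrable (fun t => ‖velocity σ t‖) MeasureTheory.volume
      (τ i) (τ (i + 1)) ∧
      InnerProductGeometry.angle (u (τ i)) (u (τ (i + 1)))
        ≤ 2 * ∫ t in (τ i)..(τ (i + 1)), ‖velocity σ t‖ := by
    intro i hi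
    rcases (hτ (Nat.le_succ i)).eq_or_lt with heq | hlt
    · rw [Nat.succ_eq_add_one] at heq
      rw [← heq, InnerProductGeometry.angle_self (hne _)]
      simp
    · have hcD := hDc i hi hlt
      have hint : IntervalIntegrable (fun t => ‖D i t‖) MeasureTheory.volume (τ i) (τ (i + 1)) :=
        ContinuousOn.intervalIntegrable (by rw [uIcc_of_le hlt.le]; exact hcD.norm)
      refine ⟨hint.congr_ae (hae i hi), ?_⟩
      have hI : ∫ t in (τ i)..(τ (i + 1)), ‖velocity σ t‖ = ∫ t in (τ i)..(τ (i + 1)), ‖D i t‖ :=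
        intervalIntegral.integral_congr_ae_restrict ((hae i hi).mono fun _ h => h.symm)
      rw [hI, ← intervalIntegral.integral_const_mul]
      refine angle_le_integral (u' := fun t => (2 * D i t) x) hlt.le (fun t _ => hunit t) ?_
        (continuousOn_const.mul hcD.norm) ?_
      · intro t ht
        have h1 : HasDerivWithinAt (opCurve σ) (D i t) (Icc (τ i) (τ (i + 1))) t :=
          ((hsm i hi).differentiableOn (by simp) t ht).hasDerivWithinAt
        have h2 := HasDerivWithinAt.symmetry h1
        exact (((ContinuousLinearMap.apply ℂ H x).restrictScalars ℝ).hasFDerivAt.comp_hasDerivWithinAt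
          t h2)
      · intro t _
        calc ‖(2 * D i t) x‖ = ‖(2 : ℂ) • D i t x‖ := by simp [two_mul, two_smul]
          _ ≤ 2 * ‖D i t‖ := by
            rw [norm_smul]
            have := (D i t).le_opNorm x
            rw [hx, mul_one] at this
            simpa using this
  have hsum : ∀ j ≤ n, InnerProductGeometry.angle (u (τ 0)) (u (τ j))
      ≤ 2 * ∑ i ∈ Finset.range j, ∫ t in (τ i)..(τ (i + 1)), ‖velocity σ t‖ := by
    intro j
    induction j with
    | zero => intro _; simp [InnerProductGeometry.angle_self (hne _)]
    | succ j ih =>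
      intro hj
      have h1 := ih (Nat.le_of_succ_le hj)
      have h2 := (hpiece j hj).2
      have h3 := InnerProductGeometry.angle_le_angle_add_angle (u (τ 0)) (u (τ j)) (u (τ (j + 1)))
      rw [Finset.sum_range_succ, mul_add]
      linarith
  have := hsum n le_rfl
  rwa [intervalIntegral.sum_integral_adjacent_intervals fun i hi => (hpiece i hi).1, hτ0, hτn]
    at this

/-- The geodesic distance is bounded below by `arcsin ‖Q - P‖`. -/
theorem arcsin_norm_sub_le_length {σ : unitInterval → Gr H} {P Q : Gr H}
    (hσ : IsPiecewiseSmooth σ) (hj : Joins σ P Q) :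
    Real.arcsin ‖(Q : H →L[ℂ] H) - P‖ ≤ length σ := by
  rcases le_or_gt (Real.pi / 2) (length σ) with hL | hL
  · exact (Real.arcsin_le_pi_div_two _).trans hL
  have h0 : opCurve σ 0 = P := by
    rw [opCurve_of_mem σ (left_mem_Icc.2 zero_le_one)]; exact congrArg Subtype.val hj.1
  have h1 : opCurve σ 1 = Q := by
    rw [opCurve_of_mem σ (right_mem_Icc.2 zero_le_one)]; exact congrArg Subtype.val hj.2
  have hLn := length_nonneg σ
  have hsin : 0 ≤ Real.sin (length σ) :=
    Real.sin_nonneg_of_nonneg_of_le_pi hLn (by linarith [Real.pi_pos])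
  refine Real.arcsin_le_iff_le_sin' ⟨by linarith [Real.pi_pos], hL⟩ |>.2 ?_
  refine ContinuousLinearMap.opNorm_le_of_unit_norm hsin fun x hx => ?_
  have h := angle_symmetry_le_two_mul_length hσ hx
  rw [h0, h1, angle_eq_two_mul_arcsin (by rw [norm_symmetry_apply P.2, hx])
    (by rw [norm_symmetry_apply Q.2, hx])] at h
  have h2 : symmetry (Q : H →L[ℂ] H) x - symmetry (P : H →L[ℂ] H) x
      = (2 : ℂ) • ((Q : H →L[ℂ] H) - P) x := by
    simp [symmetry, two_mul, two_smul]; abel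
  rw [h2, norm_smul] at h
  refine (Real.arcsin_le_iff_le_sin' ⟨by linarith [Real.pi_pos], hL⟩).1 ?_
  simpa using h

theorem IsSmooth.isPiecewiseSmooth {γ : unitInterval → Gr H} (hγ : IsSmooth γ) :
    IsPiecewiseSmooth γ := by
  refine ⟨?_, 1, fun i => if i = 0 then 0 else 1, ?_, by simp, by simp, ?_⟩
  · rw [continuous_induced_rng]
    have := continuousOn_iff_continuous_domRestrict.1 hγ.continuousOn
    exact this.congr fun t => opCurve_of_mem γ t.2
  · refine monotone_nat_of_le_succ fun i => ?_
    rcases i with _ | i <;> simp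
  · intro i hi
    obtain rfl : i = 0 := by omega
    simpa [IsSmooth] using hγ

end LowerBound

section Logarithm

variable {H : Type*} [NormedAddCommGroup H] [InnerProductSpace ℂ H] [CompleteSpace H]

/-! ### Logarithms of unitary operators -/

theorem star_neg_I_smul {B : H →L[ℂ] H} (hB : star B = -B) :
    star (-Complex.I • B) = -Complex.I • B := by
  rw [star_smul, hB]; simp

/-- A skew-adjoint operator of norm less than `π` is determined by its exponential. -/
theorem eq_of_exp_eq_exp {B C : H →L[ℂ] H} (hB : star B = -B) (hC : star C = -C)
    (hBn : ‖B‖ < Real.pi) (hCn : ‖C‖ < Real.pi) (h : exp B = exp C) : B = C := by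
  have key : ∀ (D : H →L[ℂ] H) (hD : star D = -D), ‖D‖ < Real.pi →
      ∃ x : selfAdjoint (H →L[ℂ] H), D = Complex.I • (x : H →L[ℂ] H) ∧ ‖x‖ < Real.pi := by
    intro D hD hDn
    refine ⟨⟨-Complex.I • D, star_neg_I_smul hD⟩, ?_, ?_⟩
    · simp [smul_smul]
    · change ‖-Complex.I • D‖ < _
      simpa [norm_smul] using hDn
  obtain ⟨x, rfl, hx⟩ := key B hB hBn
  obtain ⟨y, rfl, hy⟩ := key C hC hCn
  have : selfAdjoint.expUnitary x = selfAdjoint.expUnitary y := by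
    ext1; rw [selfAdjoint.expUnitary_coe, selfAdjoint.expUnitary_coe, h]
  rw [← argSelfAdjoint_expUnitary hx, this, argSelfAdjoint_expUnitary hy]

/-- The principal logarithm of a unitary `u` with `‖u - 1‖ < 2`. -/
theorem exists_log {u : H →L[ℂ] H} (hu : u ∈ unitary (H →L[ℂ] H)) (h : ‖u - 1‖ < 2) :
    ∃ B : H →L[ℂ] H, star B = -B ∧ exp B = u ∧ ‖B‖ < Real.pi ∧
      2 * (1 - Real.cos ‖B‖) = ‖u - 1‖ ^ 2 ∧
      ∀ Y, Commute u Y → Commute (star u) Y → Commute B Y := by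
  set U : unitary (H →L[ℂ] H) := ⟨u, hu⟩
  set x := Unitary.argSelfAdjoint U with hx
  have hn : ‖Complex.I • (x : H →L[ℂ] H)‖ = ‖x‖ := by rw [norm_smul]; simp
  have hcos := Unitary.two_mul_one_sub_cos_norm_argSelfAdjoint (u := U) h
  refine ⟨Complex.I • (x : H →L[ℂ] H), ?_, ?_, ?_, ?_, ?_⟩
  · rw [star_smul, x.2.star_eq]; simp
  · rw [← selfAdjoint.expUnitary_coe, expUnitary_argSelfAdjoint h]
  · rw [hn]
    refine (Unitary.norm_argSelfAdjoint_le_pi U).lt_of_ne fun hpi => ?_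
    rw [hpi, Real.cos_pi] at hcos
    have : ‖u - 1‖ ^ 2 < 2 ^ 2 := by gcongr
    change _ = ‖u - 1‖ ^ 2 at hcos
    linarith
  · rw [hn]; exact hcos
  · intro Y h1 h2
    apply Commute.smul_left
    rw [hx, Unitary.argSelfAdjoint_coe]
    exact Commute.cfc h1 h2 _

/-! ### Projections at distance less than one -/

/-- Two projections with `‖Q - P‖ < 1` are joined by the family of the logarithm of
`(2 Q - 1) (2 P - 1)`; its length is the lower bound `arcsin ‖Q - P‖`. -/
theorem exists_generator_of_norm_sub_lt_one {P Q : H →L[ℂ] H} (hP : IsStarProjection P)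
    (hQ : IsStarProjection Q) (h : ‖Q - P‖ < 1) :
    ∃ B, IsGenerator P B ∧ exp B * symmetry P = symmetry Q ∧ ‖B‖ < Real.pi ∧
      ‖B‖ / 2 = Real.arcsin ‖Q - P‖ ∧
      ∀ Y, Commute (symmetry Q * symmetry P) Y → Commute (symmetry P * symmetry Q) Y →
        Commute B Y := by
  have hPP := symmetry_mul_self hP
  have hPs := star_symmetry hP
  have hQs := star_symmetry hQ
  set S := symmetry P with hS
  set T := symmetry Q with hT
  have hSu : S ∈ unitary (H →L[ℂ] H) := symmetry_mem_unitary hP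
  have hTS : T * S ∈ unitary (H →L[ℂ] H) := mul_mem (symmetry_mem_unitary hQ) hSu
  have hnorm : ‖T * S - 1‖ = 2 * ‖Q - P‖ := by
    have : T * S - 1 = (T - S) * S := by rw [sub_mul, hPP]
    rw [this, ← norm_symmetry_sub]
    exact CStarRing.norm_mul_mem_unitary (T - S) hSu
  obtain ⟨B, hBs, hBe, hBn, hcos, hcomm⟩ := exists_log hTS (by rw [hnorm]; linarith)
  have hstar : star (T * S) = S * T := by rw [star_mul, hPs, hQs]
  rw [hstar] at hcomm
  -- `-(S B S)` is another logarithm of `T S` of norm less than `π`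
  have hanti : -(S * B * S) = B := by
    have hs : star (-(S * B * S)) = -(-(S * B * S)) := by
      rw [star_neg, star_mul, star_mul, hPs, hBs]; noncomm_ring
    refine eq_of_exp_eq_exp hs hBs ?_ hBn ?_
    · have h1 : ‖S * B * S‖ = ‖B‖ :=
        (CStarRing.norm_mul_mem_unitary (S * B) hSu).trans (CStarRing.norm_mem_unitary_mul B hSu)
      rw [norm_neg, h1]; exact hBn
    · have : NormedAlgebra ℚ (H →L[ℂ] H) := .restrictScalars ℚ ℂ _
      have h1 : SemiconjBy S (-B) (-(S * B * S)) := by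
        rw [SemiconjBy, neg_mul, mul_assoc _ S S, hPP]; noncomm_ring
      have h2 : S * exp (-B) = exp (-(S * B * S)) * S := h1.exp_right
      have h3 : exp (-B) = S * T := by
        rw [← hstar, ← hBe, NormedSpace.star_exp, hBs]
      calc exp (-(S * B * S)) = S * exp (-B) * S := by rw [h2, mul_assoc _ S S, hPP, mul_one]
        _ = exp B := by rw [h3, hBe, ← mul_assoc, hPP, one_mul]
  refine ⟨B, ⟨hBs, ?_⟩, by rw [hBe, mul_assoc, hPP, mul_one], hBn, ?_, hcomm⟩
  · change B * S = -(S * B)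
    conv_lhs => rw [← hanti]
    rw [neg_mul, mul_assoc _ S S, hPP, mul_one]
  · have hc : Real.cos ‖B‖ = 2 * Real.cos (‖B‖ / 2) ^ 2 - 1 := by
      rw [← Real.cos_two_mul]; congr 1; ring
    have h0 : 0 ≤ Real.sin (‖B‖ / 2) :=
      Real.sin_nonneg_of_nonneg_of_le_pi (by positivity) (by linarith [norm_nonneg B])
    have h2 : Real.sin (‖B‖ / 2) ^ 2 = ‖Q - P‖ ^ 2 := by
      rw [hnorm, hc] at hcos
      have := Real.sin_sq_add_cos_sq (‖B‖ / 2)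
      nlinarith
    have h3 := (pow_left_inj₀ h0 (norm_nonneg _) two_ne_zero).1 h2
    exact (Real.arcsin_eq_of_sin_eq h3 ⟨by linarith [norm_nonneg B, Real.pi_pos],
      by linarith⟩).symm

/-- A generator whose family joins `P` to `Q` with the length of the lower bound gives a minimal
geodesic. -/
theorem IsGenerator.isMinimalGeodesic {P Q : Gr H} {B : H →L[ℂ] H}
    (hB : IsGenerator (P : H →L[ℂ] H) B)
    (h : exp B * symmetry (P : H →L[ℂ] H) = symmetry (Q : H →L[ℂ] H))
    (hn : ‖B‖ / 2 ≤ Real.arcsin ‖(Q : H →L[ℂ] H) - P‖) :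
    IsMinimalGeodesic hB.geodesic P Q :=
  ⟨hB.isGeodesic_geodesic, hB.joins_geodesic h, fun σ hσ hj => by
    rw [hB.length_geodesic]
    exact hn.trans (arcsin_norm_sub_le_length hσ hj)⟩

theorem existsUnique_isMinimalGeodesic {P Q : Gr H} (h : ‖(Q : H →L[ℂ] H) - P‖ < 1) :
    ∃! γ, IsMinimalGeodesic γ P Q := by
  obtain ⟨B, hB, hBe, hBn, hBl, -⟩ := exists_generator_of_norm_sub_lt_one P.2 Q.2 h
  refine ⟨hB.geodesic, hB.isMinimalGeodesic hBe hBl.le, ?_⟩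
  rintro γ ⟨hγ, hj, hmin⟩
  obtain ⟨C, hC, rfl⟩ := hγ.exists_generator hj.1
  have hle := hmin _ hB.isGeodesic_geodesic.1.isPiecewiseSmooth (hB.joins_geodesic hBe)
  rw [hB.length_geodesic, hC.length_geodesic] at hle
  have hexp : exp C = exp B := by
    have hPP := symmetry_mul_self P.2
    have h1 := hC.exp_mul_symmetry_of_joins hj
    rw [← mul_one (exp C), ← mul_one (exp B), ← hPP, ← mul_assoc, ← mul_assoc, h1, hBe]
  obtain rfl := eq_of_exp_eq_exp hC.star_eq hB.star_eq (by linarith) hBn hexp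
  rfl

end Logarithm

section Exchange

variable {H : Type*} [NormedAddCommGroup H] [InnerProductSpace ℂ H] [CompleteSpace H]

/-! ### Exchanging `ker P ⊓ range Q` and `ker Q ⊓ range P` -/

/-- A partial isometry `V` that starts inside `ker P ⊓ range Q` and ends inside
`range P ⊓ ker Q`. -/
structure IsExchange (P Q V : H →L[ℂ] H) : Prop where
  left_mul : P * V = V
  mul_left : V * P = 0
  right_mul : Q * V = 0
  mul_right : V * Q = V
  mul_star_mul : V * star V * V = V

namespace IsExchange

variable {P Q V : H →L[ℂ] H}

theorem left_mul_star (hV : IsExchange P Q V) (hP : IsStarProjection P) : P * star V = 0 := by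
  rw [← hP.isSelfAdjoint.star_eq, ← star_mul, hV.mul_left, star_zero]

theorem star_mul_left (hV : IsExchange P Q V) (hP : IsStarProjection P) :
    star V * P = star V := by
  conv_lhs => rw [← hP.isSelfAdjoint.star_eq, ← star_mul, hV.left_mul]

theorem right_mul_star (hV : IsExchange P Q V) (hQ : IsStarProjection Q) :
    Q * star V = star V := by
  conv_lhs => rw [← hQ.isSelfAdjoint.star_eq, ← star_mul, hV.mul_right]

theorem star_mul_right (hV : IsExchange P Q V) (hQ : IsStarProjection Q) : star V * Q = 0 := by
  rw [← hQ.isSelfAdjoint.star_eq, ← star_mul, hV.right_mul, star_zero]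

theorem mul_self (hV : IsExchange P Q V) : V * V = 0 := by
  calc V * V = V * P * V := by rw [mul_assoc, hV.left_mul]
    _ = 0 := by rw [hV.mul_left, zero_mul]

theorem star_mul_star (hV : IsExchange P Q V) : star V * star V = 0 := by
  rw [← star_mul, hV.mul_self, star_zero]

theorem star_mul_mul_star (hV : IsExchange P Q V) : star V * V * star V = star V := by
  conv_rhs => rw [← hV.mul_star_mul]
  simp [mul_assoc]

end IsExchange

/-- The sum of the initial and the final projection of `V`. -/
def support (V : H →L[ℂ] H) : H →L[ℂ] H := V * star V + star V * V

/-- The rotation generator `z V - z̄ V⋆`. -/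
def rotation (V : H →L[ℂ] H) (z : ℂ) : H →L[ℂ] H := z • V - star z • star V

theorem star_rotation (V : H →L[ℂ] H) (z : ℂ) : star (rotation V z) = -rotation V z := by
  simp [rotation]

/-- The projection obtained from `Q` by exchanging the initial space of `V` for its final space. -/
def exchanged (Q V : H →L[ℂ] H) : H →L[ℂ] H := Q + V * star V - star V * V

namespace IsExchange

variable {P Q V : H →L[ℂ] H}

theorem support_mul (hV : IsExchange P Q V) : support V * V = V := by
  rw [support, add_mul, hV.mul_star_mul, mul_assoc, hV.mul_self, mul_zero, add_zero]

theorem support_mul_star (hV : IsExchange P Q V) : support V * star V = star V := by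
  rw [support, add_mul, hV.star_mul_mul_star, mul_assoc, hV.star_mul_star, mul_zero, zero_add]

theorem isStarProjection_support (hV : IsExchange P Q V) : IsStarProjection (support V) := by
  constructor
  · rw [IsIdempotentElem]
    conv_lhs => rw [support, mul_add, ← mul_assoc, ← mul_assoc]
    change support V * V * star V + support V * star V * V = _
    rw [hV.support_mul, hV.support_mul_star, support]
  · simp [support, IsSelfAdjoint]

theorem support_mul_rotation (hV : IsExchange P Q V) (z : ℂ) :
    support V * rotation V z = rotation V z := by
  rw [rotation, mul_sub, mul_smul_comm, mul_smul_comm, hV.support_mul, hV.support_mul_star]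

theorem rotation_mul_self (hV : IsExchange P Q V) {z : ℂ} (hz : ‖z‖ = 1) :
    rotation V z * rotation V z = -support V := by
  have h1 : z * star z = 1 := by
    rw [Complex.star_def, Complex.mul_conj, Complex.normSq_eq_norm_sq, hz]; simp
  have h2 : star z * z = 1 := by rw [mul_comm, h1]
  rw [rotation, mul_sub, sub_mul, sub_mul, smul_mul_smul_comm, smul_mul_smul_comm,
    smul_mul_smul_comm, smul_mul_smul_comm, hV.mul_self, hV.star_mul_star, h1, h2, support]
  simp; abel

theorem rotation_mul_support (hV : IsExchange P Q V) {z : ℂ} :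
    rotation V z * support V = rotation V z := by
  have h := congrArg star (hV.support_mul_rotation z)
  rw [star_mul, star_rotation, hV.isStarProjection_support.isSelfAdjoint.star_eq, neg_mul] at h
  exact neg_injective h

theorem exp_pi_rotation (hV : IsExchange P Q V) {z : ℂ} (hz : ‖z‖ = 1) :
    exp (Real.pi • rotation V z) = 1 - 2 * support V := by
  set J := rotation V z with hJ
  set E := support V with hE
  have hJJ : J * J = -E := hV.rotation_mul_self hz
  have hJE : J * E = J := hV.rotation_mul_support
  -- `F t` is `exp (t • J)`, because `J ^ 2 = -E` and `J` vanishes off the range of `E`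
  let F : ℝ → H →L[ℂ] H := fun t => 1 - E + Real.cos t • E + Real.sin t • J
  have hF : ∀ t, HasDerivAt F (J * F t) t := by
    intro t
    have h1 := (((Real.hasDerivAt_cos t).smul_const E).const_add (1 - E)).add
      ((Real.hasDerivAt_sin t).smul_const J)
    refine h1.congr_deriv ?_
    simp only [F, mul_add, mul_sub, mul_one, mul_smul_comm, hJJ, hJE, smul_neg, neg_smul]
    abel
  have hG : ∀ t, HasDerivAt (fun t : ℝ => exp (t • (-J)) * F t) 0 t := by
    intro t
    have h1 := (hasDerivAt_exp_smul_const (-J) t).mul (hF t)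
    have h0 : exp (t • -J) * -J * F t + exp (t • -J) * (J * F t) = 0 := by noncomm_ring
    rwa [h0] at h1
  have hc := is_const_of_deriv_eq_zero (fun t => (hG t).differentiableAt)
    (fun t => (hG t).deriv) Real.pi 0
  have h1 : F 0 = 1 := by simp [F]
  have h2 : F Real.pi = 1 - 2 * E := by simp [F, two_mul]; abel
  simp only [h1, h2, zero_smul, exp_zero, mul_one] at hc
  calc exp (Real.pi • J) = exp (Real.pi • J) * (exp (Real.pi • -J) * (1 - 2 * E)) := by
        rw [hc, mul_one]
    _ = 1 - 2 * E := by rw [← mul_assoc, smul_neg, exp_mul_exp_neg, one_mul]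

theorem isStarProjection_exchanged (hV : IsExchange P Q V) (hQ : IsStarProjection Q) :
    IsStarProjection (exchanged Q V) := by
  constructor
  · have hQQ : Q * Q = Q := hQ.isIdempotentElem
    have e1 : Q * (V * star V) = 0 := by rw [← mul_assoc, hV.right_mul, zero_mul]
    have e2 : Q * (star V * V) = star V * V := by rw [← mul_assoc, hV.right_mul_star hQ]
    have e3 : V * star V * Q = 0 := by rw [mul_assoc, hV.star_mul_right hQ, mul_zero]
    have e4 : star V * V * Q = star V * V := by rw [mul_assoc, hV.mul_right]
    have e5 : V * star V * (V * star V) = V * star V := by rw [← mul_assoc, hV.mul_star_mul]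
    have e6 : star V * V * (star V * V) = star V * V := by rw [← mul_assoc, hV.star_mul_mul_star]
    have e7 : V * star V * (star V * V) = 0 := by
      rw [← mul_assoc, mul_assoc V, hV.star_mul_star, mul_zero, zero_mul]
    have e8 : star V * V * (V * star V) = 0 := by
      rw [← mul_assoc, mul_assoc _ V V, hV.mul_self, mul_zero, zero_mul]
    rw [IsIdempotentElem, exchanged]
    simp only [add_mul, sub_mul, mul_add, mul_sub, hQQ, e1, e2, e3, e4, e5, e6, e7, e8]
    abel
  · rw [IsSelfAdjoint, exchanged, star_sub, star_add, hQ.isSelfAdjoint.star_eq]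
    simp

theorem exchanged_mul (hV : IsExchange P Q V) : exchanged Q V * V = V := by
  rw [exchanged, sub_mul, add_mul, hV.right_mul, hV.mul_star_mul, mul_assoc, hV.mul_self]; simp

theorem mul_exchanged (hV : IsExchange P Q V) : V * exchanged Q V = 0 := by
  rw [exchanged, mul_sub, mul_add, hV.mul_right, ← mul_assoc, hV.mul_self, ← mul_assoc,
    hV.mul_star_mul]; simp

theorem symmetry_eq (hV : IsExchange P Q V) (hQ : IsStarProjection Q) :
    (1 - 2 * support V) * symmetry (exchanged Q V) = symmetry Q := by
  have hsV : exchanged Q V * star V = 0 := by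
    rw [← (hV.isStarProjection_exchanged hQ).isSelfAdjoint.star_eq, ← star_mul, hV.mul_exchanged,
      star_zero]
  have h : support V * exchanged Q V = V * star V := by
    have hs : star V * exchanged Q V = star V := by
      conv_lhs => rw [← (hV.isStarProjection_exchanged hQ).isSelfAdjoint.star_eq, ← star_mul,
        hV.exchanged_mul]
    rw [support, add_mul, mul_assoc, hs, mul_assoc, hV.mul_exchanged, mul_zero, add_zero]
  have : (1 - 2 * support V) * symmetry (exchanged Q V)
      = 2 * exchanged Q V - 1 - 4 * (support V * exchanged Q V) + 2 * support V := by
    unfold symmetry; noncomm_ring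
  rw [this, h, exchanged, support, symmetry]
  noncomm_ring

end IsExchange

/-- The sum of a skew-adjoint operator vanishing on the range of a projection `E` and an operator
living on that range has at most the maximum of the two norms. -/
theorem norm_add_le_of_skew {C J E : H →L[ℂ] H} (hE : IsStarProjection E)
    (hC : star C = -C) (hCE : C * E = 0) (hEJ : E * J = J) (hJE : J * E = J) {r : ℝ}
    (hCn : ‖C‖ ≤ r) (hJn : ‖J‖ ≤ r) : ‖C + J‖ ≤ r := by
  have hr : 0 ≤ r := (norm_nonneg C).trans hCn
  refine ContinuousLinearMap.opNorm_le_bound _ hr fun x => ?_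
  have hCJ : inner ℂ (C x) (J x) = 0 := by
    have h1 : C * J = 0 := by rw [← hEJ, ← mul_assoc, hCE, zero_mul]
    rw [← ContinuousLinearMap.adjoint_inner_right]
    change inner ℂ x ((star C * J) x) = 0
    rw [hC, neg_mul, h1]; simp
  have hx : inner ℂ (x - E x) (E x) = 0 := by
    rw [← ContinuousLinearMap.adjoint_inner_left]
    change inner ℂ ((star E) (x - E x)) x = 0
    have h1 : E (E x) = E x := congrArg (· x) hE.isIdempotentElem
    rw [hE.isSelfAdjoint.star_eq, map_sub, h1, sub_self, inner_zero_left]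
  have p1 := norm_add_sq_eq_norm_sq_add_norm_sq_of_inner_eq_zero _ _ hCJ
  have p2 := norm_add_sq_eq_norm_sq_add_norm_sq_of_inner_eq_zero _ _ hx
  rw [sub_add_cancel] at p2
  have b1 : ‖C x‖ ≤ r * ‖x - E x‖ := by
    have : C x = C (x - E x) := by
      rw [map_sub]
      change _ = C x - (C * E) x
      rw [hCE]; simp
    rw [this]
    exact (C.le_opNorm _).trans (by gcongr)
  have b2 : ‖J x‖ ≤ r * ‖E x‖ := by
    have : J x = J (E x) := by
      conv_lhs => rw [← hJE]
      rfl
    rw [this]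
    exact (J.le_opNorm _).trans (by gcongr)
  change ‖C x + J x‖ ≤ _
  refine (pow_le_pow_iff_left₀ (norm_nonneg _) (by positivity) two_ne_zero).1 ?_
  have b3 := mul_self_le_mul_self (norm_nonneg _) b1
  have b4 := mul_self_le_mul_self (norm_nonneg _) b2
  calc ‖C x + J x‖ ^ 2 = ‖C x‖ * ‖C x‖ + ‖J x‖ * ‖J x‖ := by rw [sq, p1]
    _ ≤ r * ‖x - E x‖ * (r * ‖x - E x‖) + r * ‖E x‖ * (r * ‖E x‖) := add_le_add b3 b4
    _ = r ^ 2 * (‖x - E x‖ * ‖x - E x‖ + ‖E x‖ * ‖E x‖) := by ring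
    _ = (r * ‖x‖) ^ 2 := by rw [← p2]; ring

/-- If `B` commutes with the projection `E` and `exp B` is the identity on the range of `E`, then
so is the exponential of the restriction of `B`, hence `B` vanishes on the range of `E`. -/
theorem mul_eq_zero_of_exp_mul_eq {B E : H →L[ℂ] H} (hE : IsStarProjection E) (hB : star B = -B)
    (hBn : ‖B‖ < Real.pi) (hcomm : Commute B E) (h : exp B * E = E) : B * E = 0 := by
  have hexp : ∀ Y Z : H →L[ℂ] H, Y * Z = 0 → exp Y * Z = Z := by
    intro Y Z hYZ
    have : NormedAlgebra ℚ (H →L[ℂ] H) := .restrictScalars ℚ ℂ _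
    have h1 : SemiconjBy Z 0 Y := by rw [SemiconjBy, hYZ, mul_zero]
    have h2 : Z * exp 0 = exp Y * Z := h1.exp_right
    rw [← h2, exp_zero, mul_one]
  have hEE : E * E = E := hE.isIdempotentElem
  have hEE' : E * (1 - E) = 0 := by rw [mul_sub, hEE, mul_one, sub_self]
  have hEE'' : (1 - E) * E = 0 := by rw [sub_mul, hEE, one_mul, sub_self]
  refine eq_of_exp_eq_exp (C := 0) ?_ (by simp) ?_ (by simpa using Real.pi_pos) ?_
  · rw [star_mul, hB, hE.isSelfAdjoint.star_eq, mul_neg, hcomm.eq]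
  · refine lt_of_le_of_lt ((norm_mul_le _ _).trans ?_) hBn
    exact mul_le_of_le_one_right (norm_nonneg _) hE.norm_le
  · have h1 : exp (B * E) * (1 - E) = 1 - E := hexp _ _ (by rw [mul_assoc, hEE', mul_zero])
    have hc : Commute (B * E) (B * (1 - E)) := by
      have hce : Commute B (1 - E) := (Commute.one_right B).sub_right hcomm
      have hee : Commute E (1 - E) := by rw [Commute, SemiconjBy, hEE', hEE'']
      exact ((Commute.refl B).mul_right hce).mul_left (hcomm.symm.mul_right hee)
    have h2 : exp (B * E) * E = E := by
      have h3 : exp (B * (1 - E)) * E = E := hexp _ _ (by rw [mul_assoc, hEE'', mul_zero])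
      have h4 : B = B * E + B * (1 - E) := by rw [← mul_add]; simp
      calc exp (B * E) * E = exp (B * E) * exp (B * (1 - E)) * E := by rw [mul_assoc, h3]
        _ = exp B * E := by rw [← exp_add_operator hc, ← h4]
        _ = E := h
    calc exp (B * E) = exp (B * E) * E + exp (B * E) * (1 - E) := by rw [← mul_add]; simp
      _ = exp 0 := by rw [h1, h2, exp_zero]; simp

/-- A nonzero exchange, together with the remaining part at distance less than one, yields one
minimal geodesic of length `π / 2` for every point of the unit circle. -/
theorem infinite_isMinimalGeodesic {P Q : Gr H} {V : H →L[ℂ] H}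
    (hV : IsExchange (P : H →L[ℂ] H) Q V) (hV0 : V ≠ 0)
    (h : ‖exchanged (Q : H →L[ℂ] H) V - P‖ < 1)
    (hPQ : ‖(Q : H →L[ℂ] H) - P‖ = 1) : {γ | IsMinimalGeodesic γ P Q}.Infinite := by
  have hQ' := hV.isStarProjection_exchanged Q.2
  obtain ⟨C, hC, hCe, hCn, -, hcomm⟩ := exists_generator_of_norm_sub_lt_one P.2 hQ' h
  set S := symmetry (P : H →L[ℂ] H) with hS
  set T := symmetry (exchanged (Q : H →L[ℂ] H) V) with hT
  set E := support V with hE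
  have hSV : S * V = V := by rw [hS, symmetry, sub_mul, mul_assoc, hV.left_mul]; noncomm_ring
  have hVS : V * S = -V := by
    have : V * S = 2 * (V * P) - V := by rw [hS, symmetry]; noncomm_ring
    rw [this, hV.mul_left]; simp
  have hTV : T * V = V := by rw [hT, symmetry, sub_mul, mul_assoc, hV.exchanged_mul]; noncomm_ring
  have hVT : V * T = -V := by
    have : V * T = 2 * (V * exchanged (Q : H →L[ℂ] H) V) - V := by rw [hT, symmetry]; noncomm_ring
    rw [this, hV.mul_exchanged]; simp
  have hSs : star S = S := star_symmetry P.2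
  have hTs : star T = T := star_symmetry hQ'
  have hWS : star V * S = star V := by
    conv_lhs => rw [← hSs, ← star_mul, hSV]
  have hSW : S * star V = -star V := by
    conv_lhs => rw [← hSs, ← star_mul, hVS, star_neg]
  have hTW : T * star V = -star V := by
    conv_lhs => rw [← hTs, ← star_mul, hVT, star_neg]
  have hWT : star V * T = star V := by
    conv_lhs => rw [← hTs, ← star_mul, hTV]
  have hCV : Commute C V := by
    apply hcomm
    · rw [Commute, SemiconjBy, mul_assoc, hSV, hTV, ← mul_assoc, hVT, neg_mul, hVS, neg_neg]
    · rw [Commute, SemiconjBy, mul_assoc, hTV, hSV, ← mul_assoc, hVS, neg_mul, hVT, neg_neg]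
  have hCW : Commute C (star V) := by
    apply hcomm
    · rw [Commute, SemiconjBy, mul_assoc, hSW, mul_neg, hTW, neg_neg, ← mul_assoc, hWT, hWS]
    · rw [Commute, SemiconjBy, mul_assoc, hTW, mul_neg, hSW, neg_neg, ← mul_assoc, hWS, hWT]
  have hCEc : Commute C E := (hCV.mul_right hCW).add_right (hCW.mul_right hCV)
  have hEp := hV.isStarProjection_support
  have hexpC : exp C = T * S := by
    rw [← hCe, mul_assoc, symmetry_mul_self P.2, mul_one]
  have hCE : C * E = 0 := by
    refine mul_eq_zero_of_exp_mul_eq hEp hC.star_eq hCn hCEc ?_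
    rw [hexpC, hE, support, mul_add, ← mul_assoc, ← mul_assoc, mul_assoc T, hSV, hTV,
      mul_assoc T S, hSW, mul_neg, hTW, neg_neg]
  -- the family of generators
  let B : Circle → H →L[ℂ] H := fun z => C + Real.pi • rotation V z
  have hBgen : ∀ z, IsGenerator (P : H →L[ℂ] H) (B z) := by
    intro z
    constructor
    · simp only [B, star_add, star_smul, star_rotation, hC.star_eq]; simp; abel
    · have hJ : rotation V z * S = -(S * rotation V z) := by
        rw [rotation, sub_mul, mul_sub, smul_mul_assoc, smul_mul_assoc, mul_smul_comm,
          mul_smul_comm, hVS, hWS, hSV, hSW]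
        simp; abel
      change (C + Real.pi • rotation V z) * S = -(S * (C + Real.pi • rotation V z))
      rw [add_mul, mul_add, hC.anticomm, smul_mul_assoc, hJ, mul_smul_comm, smul_neg]; abel
  have hBexp : ∀ z, exp (B z) * S = symmetry (Q : H →L[ℂ] H) := by
    intro z
    have hCJ : Commute C (Real.pi • rotation V z) :=
      ((hCV.smul_right _).sub_right (hCW.smul_right _)).smul_right _
    have h1 : exp (B z) = exp (Real.pi • rotation V z) * exp C := by
      rw [← exp_add_operator hCJ.symm, add_comm]
    rw [h1, hV.exp_pi_rotation (Circle.norm_coe z), mul_assoc, hCe, hV.symmetry_eq Q.2]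
  have hBnorm : ∀ z, ‖B z‖ ≤ Real.pi := by
    intro z
    have hJn : ‖rotation V (z : ℂ)‖ ≤ 1 := by
      have h1 : ‖rotation V (z : ℂ)‖ * ‖rotation V (z : ℂ)‖ ≤ 1 := by
        rw [← CStarRing.norm_star_mul_self, star_rotation, neg_mul,
          hV.rotation_mul_self (Circle.norm_coe z), neg_neg]
        exact hEp.norm_le
      nlinarith [norm_nonneg (rotation V (z : ℂ))]
    refine norm_add_le_of_skew hEp hC.star_eq hCE ?_ ?_ hCn.le ?_
    · rw [mul_smul_comm, hV.support_mul_rotation]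
    · rw [smul_mul_assoc, hV.rotation_mul_support]
    · rw [norm_smul, Real.norm_eq_abs, abs_of_pos Real.pi_pos]
      exact mul_le_of_le_one_right Real.pi_pos.le hJn
  have hmin : ∀ z, IsMinimalGeodesic (hBgen z).geodesic P Q := by
    intro z
    refine (hBgen z).isMinimalGeodesic (hBexp z) ?_
    rw [hPQ, Real.arcsin_one]
    linarith [hBnorm z]
  have : Infinite Circle :=
    have : Infinite (Ioc (-Real.pi) Real.pi) :=
      (Ioc_infinite (by linarith [Real.pi_pos])).to_subtype
    Infinite.of_injective _ Circle.argEquiv.symm.injective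
  refine infinite_of_injective_forall_mem (f := fun z => (hBgen z).geodesic) ?_ hmin
  intro z z' heq
  have h0 : (0 : ℝ) ∈ Icc (0 : ℝ) 1 := ⟨le_rfl, zero_le_one⟩
  have hv : velocity (hBgen z).geodesic 0 = velocity (hBgen z').geodesic 0 := by
    rw [show (hBgen z).geodesic = (hBgen z').geodesic from heq]
  rw [(hBgen z).velocity_geodesic h0, (hBgen z').velocity_geodesic h0] at hv
  simp only [zero_smul, exp_zero, one_mul] at hv
  have hBS := smul_right_injective (H →L[ℂ] H) (inv_ne_zero (two_ne_zero (α := ℝ))) hv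
  have hBB : B z = B z' := by
    have := congrArg (· * S) hBS
    simpa only [mul_assoc, hS, symmetry_mul_self P.2, mul_one] using this
  have hJJ : rotation V z = rotation V z' :=
    smul_right_injective (H →L[ℂ] H) Real.pi_ne_zero (add_left_cancel hBB)
  have hPJ : ∀ c : ℂ, (P : H →L[ℂ] H) * rotation V c = c • V := by
    intro c
    rw [rotation, mul_sub, mul_smul_comm, mul_smul_comm, hV.left_mul, hV.left_mul_star P.2]
    simp
  have hzV : (z : ℂ) • V = (z' : ℂ) • V := by rw [← hPJ, hJJ, hPJ]
  exact Circle.ext (smul_left_injective ℂ hV0 hzV)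

end Exchange

section FiniteKernels

variable {H : Type*} [NormedAddCommGroup H] [InnerProductSpace ℂ H]

/-! ### Projections with finite-dimensional kernels -/

/-- The subspace `ker P ⊓ range Q`, for projections `P` and `Q`. -/
def kerInfRange (P Q : H →L[ℂ] H) : Submodule ℂ H :=
  LinearMap.ker (P : H →ₗ[ℂ] H) ⊓ LinearMap.ker ((1 - Q : H →L[ℂ] H) : H →ₗ[ℂ] H)

theorem mem_kerInfRange {P Q : H →L[ℂ] H} {x : H} :
    x ∈ kerInfRange P Q ↔ P x = 0 ∧ Q x = x := by
  change P x = 0 ∧ x - Q x = 0 ↔ _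
  rw [sub_eq_zero, eq_comm (a := x)]

variable [CompleteSpace H]

theorem inner_apply_left {P : H →L[ℂ] H} (hP : IsStarProjection P) (x y : H) :
    inner ℂ (P x) y = inner ℂ x (P y) := by
  rw [← ContinuousLinearMap.adjoint_inner_right]
  change inner ℂ x ((star P) y) = _
  rw [hP.isSelfAdjoint.star_eq]

theorem apply_apply {P : H →L[ℂ] H} (hP : IsStarProjection P) (x : H) : P (P x) = P x :=
  congrArg (· x) hP.isIdempotentElem

theorem apply_sub_apply {P : H →L[ℂ] H} (hP : IsStarProjection P) (x : H) :
    P (x - P x) = 0 := by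
  rw [map_sub, apply_apply hP, sub_self]

/-- The parallelogram law for the images of `x` under the two symmetries. -/
theorem norm_sub_apply_sq {P Q : H →L[ℂ] H} (hP : IsStarProjection P) (hQ : IsStarProjection Q)
    (x : H) : ‖(Q - P) x‖ ^ 2 = ‖x‖ ^ 2 - ‖Q x + P x - x‖ ^ 2 := by
  have h := parallelogram_law_with_norm ℂ (symmetry Q x) (symmetry P x)
  rw [norm_symmetry_apply hP, norm_symmetry_apply hQ] at h
  have h1 : symmetry Q x - symmetry P x = (2 : ℂ) • ((Q - P) x) := by
    simp [symmetry, two_mul, two_smul]; abel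
  have h2 : symmetry Q x + symmetry P x = (2 : ℂ) • (Q x + P x - x) := by
    simp [symmetry, two_mul, two_smul]; abel
  rw [h1, h2, norm_smul, norm_smul] at h
  simp only [Complex.norm_ofNat] at h
  linarith

theorem norm_sub_le_one {P Q : H →L[ℂ] H} (hP : IsStarProjection P) (hQ : IsStarProjection Q) :
    ‖Q - P‖ ≤ 1 := by
  refine ContinuousLinearMap.opNorm_le_bound _ zero_le_one fun x => ?_
  rw [one_mul]
  refine (pow_le_pow_iff_left₀ (norm_nonneg _) (norm_nonneg _) two_ne_zero).1 ?_
  rw [norm_sub_apply_sq hP hQ]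
  linarith [sq_nonneg ‖Q x + P x - x‖]

theorem norm_sub_eq_one {P Q : H →L[ℂ] H} (hP : IsStarProjection P) (hQ : IsStarProjection Q)
    (h : kerInfRange P Q ≠ ⊥) : ‖Q - P‖ = 1 := by
  refine le_antisymm (norm_sub_le_one hP hQ) ?_
  obtain ⟨x, hx, hx0⟩ := Submodule.exists_mem_ne_zero_of_ne_bot h
  rw [mem_kerInfRange] at hx
  have h1 := (Q - P).le_opNorm x
  have h2 : (Q - P) x = x := by simp [hx.1, hx.2]
  rw [h2] at h1
  exact (le_mul_iff_one_le_left (norm_pos_iff.2 hx0)).1 h1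

/-- If the difference has finite rank and `ker P ⊓ range Q` and `ker Q ⊓ range P` are both zero,
then the norm of the difference, which is attained, is less than one. -/
theorem norm_sub_lt_one {P Q : H →L[ℂ] H} (hP : IsStarProjection P) (hQ : IsStarProjection Q)
    (M : Submodule ℂ H) [FiniteDimensional ℂ M] (hM : ∀ x, (Q - P) x ∈ M)
    (h1 : kerInfRange P Q = ⊥) (h2 : kerInfRange Q P = ⊥) : ‖Q - P‖ < 1 := by
  set D := Q - P with hD
  have hlt : ∀ x, x ≠ 0 → ‖D x‖ < ‖x‖ := by
    intro x hx
    refine (pow_lt_pow_iff_left₀ (norm_nonneg _) (norm_nonneg _) two_ne_zero).1 ?_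
    rw [norm_sub_apply_sq hP hQ]
    have : Q x + P x - x ≠ 0 := by
      intro h0
      have hxe : Q x + P x = x := sub_eq_zero.1 h0
      have hPQ : P (Q x) = 0 := by
        have := congrArg P hxe
        rwa [map_add, apply_apply hP, add_eq_right] at this
      have hQP : Q (P x) = 0 := by
        have := congrArg Q hxe
        rwa [map_add, apply_apply hQ, add_eq_left] at this
      have hQx : Q x ∈ kerInfRange P Q := mem_kerInfRange.2 ⟨hPQ, apply_apply hQ x⟩
      have hPx : P x ∈ kerInfRange Q P := mem_kerInfRange.2 ⟨hQP, apply_apply hP x⟩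
      rw [h1, Submodule.mem_bot] at hQx
      rw [h2, Submodule.mem_bot] at hPx
      rw [hQx, hPx, add_zero] at hxe
      exact hx hxe.symm
    have := pow_pos (norm_pos_iff.2 this) 2
    linarith
  have hproj : ∀ x, D x = D (M.starProjection x) := by
    intro x
    rw [← sub_eq_zero, ← map_sub, ← inner_self_eq_zero (𝕜 := ℂ)]
    have hsa : ∀ y z, inner ℂ (D y) z = inner ℂ y (D z) := fun y z => by
      simp only [hD, _root_.sub_apply, inner_sub_left, inner_sub_right,
        inner_apply_left hP, inner_apply_left hQ]
    rw [hsa]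
    exact (M.mem_orthogonal' _).1 (M.sub_starProjection_mem_orthogonal x) _ (hM _)
  obtain ⟨r, hr0, hr1, hr⟩ : ∃ r : ℝ, 0 ≤ r ∧ r < 1 ∧ ∀ x : M, ‖x‖ = 1 → ‖D x‖ ≤ r := by
    rcases (Metric.sphere (0 : M) 1).eq_empty_or_nonempty with he | hne
    · refine ⟨0, le_rfl, zero_lt_one, fun x hx => ?_⟩
      exact absurd (show x ∈ Metric.sphere (0 : M) 1 by simpa using hx) (by simp [he])
    · obtain ⟨x, hx, hmax⟩ := (isCompact_sphere (0 : M) 1).exists_isMaxOn hne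
        (f := fun x : M => ‖D x‖) (by fun_prop)
      have hx1 : ‖x‖ = 1 := by simpa using hx
      refine ⟨‖D x‖, norm_nonneg _, ?_, fun y hy => hmax (by simpa using hy)⟩
      rw [← hx1]
      refine hlt x fun h0 => ?_
      have h3 : ‖(x : H)‖ = 1 := hx1
      rw [h0, norm_zero] at h3
      exact zero_ne_one h3
  refine lt_of_le_of_lt (ContinuousLinearMap.opNorm_le_bound _ hr0 fun x => ?_) hr1
  have hM1 : ∀ y : M, ‖D y‖ ≤ r * ‖y‖ := by
    intro y
    rcases eq_or_ne y 0 with rfl | hy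
    · simp
    · have hy' : ‖y‖ ≠ 0 := norm_ne_zero_iff.2 hy
      have h3 : ‖((‖y‖⁻¹ : ℝ) : ℂ) • y‖ = 1 := by
        rw [norm_smul, Complex.norm_real, norm_inv, norm_norm, inv_mul_cancel₀ hy']
      have h4 := hr _ h3
      rw [Submodule.coe_smul, map_smul, norm_smul, Complex.norm_real, norm_inv, norm_norm,
        inv_mul_le_iff₀ (by positivity), mul_comm] at h4
      exact h4
  rw [hproj x]
  have hpn : ‖M.starProjection x‖ ≤ ‖x‖ := by
    simpa using (M.starProjection.le_opNorm x).trans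
      (mul_le_mul_of_nonneg_right M.starProjection_norm_le (norm_nonneg x))
  exact (hM1 ⟨M.starProjection x, M.starProjection_apply_mem x⟩).trans (by gcongr; exact hpn)

/-- By rank-nullity for `1 - P : ker Q → ker P`, whose kernel is `ker Q ⊓ range P` and whose range
is orthogonal to `ker P ⊓ range Q`. -/
theorem finrank_kerInfRange_le {P Q : H →L[ℂ] H} (hP : IsStarProjection P)
    (hQ : IsStarProjection Q) [FiniteDimensional ℂ (LinearMap.ker (P : H →ₗ[ℂ] H))]
    [FiniteDimensional ℂ (LinearMap.ker (Q : H →ₗ[ℂ] H))]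
    (h : Module.finrank ℂ (LinearMap.ker (P : H →ₗ[ℂ] H))
      = Module.finrank ℂ (LinearMap.ker (Q : H →ₗ[ℂ] H))) :
    Module.finrank ℂ (kerInfRange P Q) ≤ Module.finrank ℂ (kerInfRange Q P) := by
  set KP := LinearMap.ker (P : H →ₗ[ℂ] H)
  set KQ := LinearMap.ker (Q : H →ₗ[ℂ] H)
  let T : KQ →ₗ[ℂ] H := (((1 - P : H →L[ℂ] H) : H →ₗ[ℂ] H)).domRestrict KQ
  have hT : ∀ x : KQ, T x = (x : H) - P x := fun x => by simp [T]
  have hrn := T.finrank_range_add_finrank_ker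
  have hker : (LinearMap.ker T).map KQ.subtype = kerInfRange Q P := by
    ext x
    simp only [Submodule.mem_map, LinearMap.mem_ker, hT, mem_kerInfRange, sub_eq_zero]
    constructor
    · rintro ⟨y, hy, rfl⟩
      exact ⟨y.2, hy.symm⟩
    · rintro ⟨h1, h2⟩
      exact ⟨⟨x, h1⟩, h2.symm, rfl⟩
  have hker' : Module.finrank ℂ (LinearMap.ker T) = Module.finrank ℂ (kerInfRange Q P) := by
    rw [← hker]
    exact (Submodule.finrank_map_subtype_eq KQ _).symm
  have hle : kerInfRange P Q ⊔ LinearMap.range T ≤ KP := by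
    refine sup_le inf_le_left ?_
    rintro _ ⟨x, rfl⟩
    rw [hT]
    exact apply_sub_apply hP _
  -- the two subspaces are orthogonal
  have hdisj : kerInfRange P Q ⊓ LinearMap.range T = ⊥ := by
    rw [eq_bot_iff]
    rintro _ ⟨hy, x, rfl⟩
    rw [SetLike.mem_coe, mem_kerInfRange] at hy
    rw [Submodule.mem_bot, ← inner_self_eq_zero (𝕜 := ℂ)]
    have h1 : inner ℂ (T x) (T x) = inner ℂ (T x) (x : H) := by
      conv_lhs => rw [hT x]
      rw [inner_sub_right, ← hT x, ← inner_apply_left hP, hy.1, inner_zero_left, sub_zero]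
    have h2 : Q (x : H) = 0 := x.2
    rw [h1, ← hy.2, inner_apply_left hQ, h2, inner_zero_right]
  have hKP : FiniteDimensional ℂ (kerInfRange P Q) :=
    Submodule.finiteDimensional_of_le inf_le_left
  have hsum := Submodule.finrank_sup_add_finrank_inf_eq (kerInfRange P Q) (LinearMap.range T)
  rw [hdisj, finrank_bot] at hsum
  have hle' := Submodule.finrank_mono hle
  omega

end FiniteKernels

section ZeroSpaces

variable {H : Type*} [NormedAddCommGroup H] [InnerProductSpace ℂ H] [CompleteSpace H]

/-! ### Minimal geodesics between projections with kernels of equal dimension -/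

theorem exists_isExchange {P Q : H →L[ℂ] H} (hP : IsStarProjection P)
    (hQ : IsStarProjection Q) [FiniteDimensional ℂ (kerInfRange P Q)]
    [FiniteDimensional ℂ (kerInfRange Q P)]
    (h : Module.finrank ℂ (kerInfRange P Q) = Module.finrank ℂ (kerInfRange Q P)) :
    ∃ V, IsExchange P Q V ∧ star V * V = (kerInfRange P Q).starProjection ∧
      V * star V = (kerInfRange Q P).starProjection := by
  set K := kerInfRange P Q
  set L := kerInfRange Q P
  let e : K ≃ₗᵢ[ℂ] L :=
    (stdOrthonormalBasis ℂ K).equiv (stdOrthonormalBasis ℂ L) (finCongr h)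
  let V : H →L[ℂ] H := L.subtypeL ∘L (e : K →L[ℂ] L) ∘L K.orthogonalProjectionOnto
  let W : H →L[ℂ] H := K.subtypeL ∘L (e.symm : L →L[ℂ] K) ∘L L.orthogonalProjectionOnto
  have hVa : ∀ x, V x = (e (K.orthogonalProjectionOnto x) : H) := fun x => rfl
  have hWa : ∀ x, W x = (e.symm (L.orthogonalProjectionOnto x) : H) := fun x => rfl
  have hW : star V = W := by
    symm
    refine (ContinuousLinearMap.eq_adjoint_iff _ _).2 fun x y => ?_
    rw [hVa, hWa, ← Submodule.inner_orthogonalProjectionOnto_eq_of_mem_left,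
      ← Submodule.inner_orthogonalProjectionOnto_eq_of_mem_right]
    rw [← e.inner_map_map, e.apply_symm_apply]
  have hKP : ∀ y : K, P y = 0 ∧ Q y = y := fun y => mem_kerInfRange.1 y.2
  have hLP : ∀ y : L, Q y = 0 ∧ P y = y := fun y => mem_kerInfRange.1 y.2
  have hpP : ∀ x, K.orthogonalProjectionOnto (P x) = 0 := by
    intro x
    rw [Submodule.orthogonalProjectionOnto_eq_zero_iff, Submodule.mem_orthogonal]
    intro y hy
    rw [← inner_apply_left hP, (hKP ⟨y, hy⟩).1, inner_zero_left]
  have hpQ : ∀ x, K.orthogonalProjectionOnto (Q x) = K.orthogonalProjectionOnto x := by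
    intro x
    rw [← sub_eq_zero, ← map_sub, Submodule.orthogonalProjectionOnto_eq_zero_iff,
      Submodule.mem_orthogonal]
    intro y hy
    rw [inner_sub_right, ← inner_apply_left hQ, (hKP ⟨y, hy⟩).2, sub_self]
  have hWV : W * V = K.starProjection := by
    ext x
    change W (V x) = (K.orthogonalProjectionOnto x : H)
    rw [hVa, hWa, Submodule.orthogonalProjectionOnto_mem_subspace_eq_self, e.symm_apply_apply]
  have hVW : V * W = L.starProjection := by
    ext x
    change V (W x) = (L.orthogonalProjectionOnto x : H)
    rw [hVa, hWa, Submodule.orthogonalProjectionOnto_mem_subspace_eq_self, e.apply_symm_apply]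
  refine ⟨V, ⟨?_, ?_, ?_, ?_, ?_⟩, by rw [hW, hWV], by rw [hW, hVW]⟩
  · ext x; exact (hLP _).2
  · ext x
    change V (P x) = 0
    rw [hVa, hpP]; simp
  · ext x; exact (hLP _).1
  · ext x
    change V (Q x) = V x
    rw [hVa, hVa, hpQ]
  · rw [hW, hVW]
    ext x
    change (L.orthogonalProjectionOnto (V x) : H) = V x
    rw [hVa, Submodule.orthogonalProjectionOnto_mem_subspace_eq_self]

/-- After the exchange, `ker P ⊓ range Q'` and `ker Q' ⊓ range P` are both zero. -/
theorem norm_exchanged_sub_lt_one {P Q V : H →L[ℂ] H} (hP : IsStarProjection P)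
    (hQ : IsStarProjection Q) [FiniteDimensional ℂ (LinearMap.ker (P : H →ₗ[ℂ] H))]
    [FiniteDimensional ℂ (LinearMap.ker (Q : H →ₗ[ℂ] H))] (hV : IsExchange P Q V)
    (h1 : ∀ x ∈ kerInfRange P Q, star V (V x) = x)
    (h2 : ∀ x ∈ kerInfRange Q P, V (star V x) = x) : ‖exchanged Q V - P‖ < 1 := by
  set W := star V with hW
  have hap : ∀ x, exchanged Q V x = Q x + V (W x) - W (V x) := fun x => rfl
  have hQV : ∀ x, Q (V x) = 0 := fun x => congrArg (· x) hV.right_mul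
  have hVP : ∀ x, V (P x) = 0 := fun x => congrArg (· x) hV.mul_left
  have hPW : ∀ x, P (W x) = 0 := fun x => congrArg (· x) (hV.left_mul_star hP)
  have hWP : ∀ x, W (P x) = W x := fun x => congrArg (· x) (hV.star_mul_left hP)
  have hQW : ∀ x, Q (W x) = W x := fun x => congrArg (· x) (hV.right_mul_star hQ)
  refine norm_sub_lt_one hP (hV.isStarProjection_exchanged hQ)
    (LinearMap.ker (P : H →ₗ[ℂ] H) ⊔ LinearMap.ker (Q : H →ₗ[ℂ] H)) ?_ ?_ ?_
  · intro x
    refine Submodule.mem_sup.2 ⟨x - P x - W (V x), ?_, V (W x) - (x - Q x), ?_, ?_⟩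
    · change P (x - P x - W (V x)) = 0
      rw [map_sub, apply_sub_apply hP, hPW, sub_zero]
    · change Q (V (W x) - (x - Q x)) = 0
      rw [map_sub, apply_sub_apply hQ, hQV, sub_zero]
    · rw [_root_.sub_apply, hap]; abel
  · rw [eq_bot_iff]
    intro x hx
    rw [mem_kerInfRange, hap] at hx
    obtain ⟨hPx, hx⟩ := hx
    have hWx : W x = 0 := by rw [← hWP, hPx, map_zero]
    rw [hWx, map_zero, add_zero] at hx
    have h3 : W (V x) = 0 := by
      have := congrArg Q hx
      rwa [map_sub, apply_apply hQ, hQW, sub_eq_self] at this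
    rw [h3, sub_zero] at hx
    rw [h1 x (mem_kerInfRange.2 ⟨hPx, hx⟩)] at h3
    exact h3
  · rw [eq_bot_iff]
    intro x hx
    rw [mem_kerInfRange, hap] at hx
    obtain ⟨hx, hPx⟩ := hx
    have hVx : V x = 0 := by rw [← hPx, hVP]
    rw [hVx, map_zero, sub_zero] at hx
    have h3 : Q x = 0 := by
      have := congrArg Q hx
      rwa [map_add, apply_apply hQ, hQV, add_zero, map_zero] at this
    rw [h3, zero_add, h2 x (mem_kerInfRange.2 ⟨h3, hPx⟩)] at hx
    exact hx

/-- The case distinction for minimal geodesics between projections whose kernels have the same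
finite dimension. -/
theorem isMinimalGeodesic_dichotomy {P Q : Gr H}
    [FiniteDimensional ℂ (LinearMap.ker ((P : H →L[ℂ] H) : H →ₗ[ℂ] H))]
    [FiniteDimensional ℂ (LinearMap.ker ((Q : H →L[ℂ] H) : H →ₗ[ℂ] H))]
    (h : Module.finrank ℂ (LinearMap.ker ((P : H →L[ℂ] H) : H →ₗ[ℂ] H))
      = Module.finrank ℂ (LinearMap.ker ((Q : H →L[ℂ] H) : H →ₗ[ℂ] H))) :
    (kerInfRange (Q : H →L[ℂ] H) P = ⊥ → ∃! γ, IsMinimalGeodesic γ P Q) ∧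
    (kerInfRange (Q : H →L[ℂ] H) P ≠ ⊥ → {γ | IsMinimalGeodesic γ P Q}.Infinite) := by
  have hK : FiniteDimensional ℂ (kerInfRange (P : H →L[ℂ] H) Q) :=
    Submodule.finiteDimensional_of_le inf_le_left
  have hL : FiniteDimensional ℂ (kerInfRange (Q : H →L[ℂ] H) P) :=
    Submodule.finiteDimensional_of_le inf_le_left
  have hfin := le_antisymm (finrank_kerInfRange_le P.2 Q.2 h)
    (finrank_kerInfRange_le Q.2 P.2 h.symm)
  have hbot : kerInfRange (P : H →L[ℂ] H) Q = ⊥ ↔ kerInfRange (Q : H →L[ℂ] H) P = ⊥ := by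
    rw [← Submodule.finrank_eq_zero (R := ℂ), hfin, Submodule.finrank_eq_zero]
  obtain ⟨V, hV, hVV, hVV'⟩ := exists_isExchange P.2 Q.2 hfin
  have h1 : ∀ x ∈ kerInfRange (P : H →L[ℂ] H) Q, star V (V x) = x := fun x hx => by
    change (star V * V) x = x
    rw [hVV, Submodule.starProjection_eq_self_iff.2 hx]
  have h2 : ∀ x ∈ kerInfRange (Q : H →L[ℂ] H) P, V (star V x) = x := fun x hx => by
    change (V * star V) x = x
    rw [hVV', Submodule.starProjection_eq_self_iff.2 hx]
  have hlt := norm_exchanged_sub_lt_one P.2 Q.2 hV h1 h2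
  constructor
  · intro h0
    apply existsUnique_isMinimalGeodesic
    refine norm_sub_lt_one P.2 Q.2 (LinearMap.ker ((P : H →L[ℂ] H) : H →ₗ[ℂ] H) ⊔
      LinearMap.ker ((Q : H →L[ℂ] H) : H →ₗ[ℂ] H)) ?_ (hbot.2 h0) h0
    intro x
    refine Submodule.mem_sup.2 ⟨x - (P : H →L[ℂ] H) x, apply_sub_apply P.2 x,
      -(x - (Q : H →L[ℂ] H) x), neg_mem (apply_sub_apply Q.2 x), ?_⟩
    rw [_root_.sub_apply]; abel
  · intro h0
    refine infinite_isMinimalGeodesic hV ?_ hlt (norm_sub_eq_one P.2 Q.2 (mt hbot.1 h0))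
    rintro rfl
    obtain ⟨x, hx, hx0⟩ := Submodule.exists_mem_ne_zero_of_ne_bot h0
    exact hx0 (by simpa using (h2 x hx).symm)

/-! ### Curves preserve the dimension of the kernel -/

/-- If `‖Q - P‖ < 1`, then `1 - Q` is injective on `ker P`. -/
theorem rank_ker_le {P Q : H →L[ℂ] H} (hQ : IsStarProjection Q)
    (h : ‖Q - P‖ < 1) : Module.rank ℂ (LinearMap.ker (P : H →ₗ[ℂ] H))
      ≤ Module.rank ℂ (LinearMap.ker (Q : H →ₗ[ℂ] H)) := by
  let f : LinearMap.ker (P : H →ₗ[ℂ] H) →ₗ[ℂ] LinearMap.ker (Q : H →ₗ[ℂ] H) :=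
    ((((1 - Q : H →L[ℂ] H) : H →ₗ[ℂ] H)).domRestrict _).codRestrict _
      fun x => apply_sub_apply hQ x
  refine LinearMap.rank_le_of_injective f ?_
  rw [injective_iff_map_eq_zero]
  intro x hx
  have h1 : (x : H) - Q x = 0 := congrArg Subtype.val hx
  have h2 : P (x : H) = 0 := x.2
  have h3 : (Q - P) (x : H) = x := by
    rw [_root_.sub_apply, h2, sub_zero]; exact (sub_eq_zero.1 h1).symm
  have h4 := (Q - P).le_opNorm (x : H)
  rw [h3] at h4
  by_contra h0
  have hpos : 0 < ‖(x : H)‖ := norm_pos_iff.2 fun h => h0 (Subtype.ext h)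
  nlinarith

theorem rank_ker_eq_of_joins {γ : unitInterval → Gr H} {P Q : Gr H} (hγ : Continuous γ)
    (hj : Joins γ P Q) :
    Module.rank ℂ (LinearMap.ker ((P : H →L[ℂ] H) : H →ₗ[ℂ] H))
      = Module.rank ℂ (LinearMap.ker ((Q : H →L[ℂ] H) : H →ₗ[ℂ] H)) := by
  have hloc : IsLocallyConstant fun t =>
      Module.rank ℂ (LinearMap.ker ((γ t : H →L[ℂ] H) : H →ₗ[ℂ] H)) := by
    rw [IsLocallyConstant.iff_eventually_eq]
    intro t
    have hc : Continuous fun s => (γ s : H →L[ℂ] H) := continuous_subtype_val.comp hγ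
    filter_upwards [hc.continuousAt.eventually (Metric.ball_mem_nhds _ one_pos)] with s hs
    rw [dist_eq_norm] at hs
    exact le_antisymm (rank_ker_le (γ t).2 (by rwa [norm_sub_rev])) (rank_ker_le (γ s).2 hs)
  have := hloc.apply_eq_of_preconnectedSpace 0 1
  rwa [hj.1, hj.2] at this

/-! ### Zero sets in a reproducing kernel Hilbert space -/

section ZeroSets

variable {X : Type*} (H) [RKHS ℂ H X ℂ]

theorem zeroSubspace_range {ι : Type*} (a : ι → X) :
    zeroSubspace H (range a) = (Submodule.span ℂ (range fun i => ker H (a i)))ᗮ := by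
  ext f
  rw [Submodule.mem_orthogonal]
  constructor
  · intro hf u hu
    induction hu using Submodule.span_induction with
    | mem u hu =>
      obtain ⟨i, rfl⟩ := hu
      rw [inner_ker]
      exact hf _ ⟨i, rfl⟩
    | zero => exact inner_zero_left _
    | add u v _ _ hu hv => rw [inner_add_left, hu, hv, add_zero]
    | smul c u _ hu => rw [inner_smul_left, hu, mul_zero]
  · rintro hf _ ⟨i, rfl⟩
    rw [← inner_ker]
    exact hf _ (Submodule.subset_span ⟨i, rfl⟩)

theorem ker_Z {ι : Type*} [Finite ι] (a : ι → X) :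
    LinearMap.ker ((Z H (range a) : H →L[ℂ] H) : H →ₗ[ℂ] H)
      = Submodule.span ℂ (range fun i => ker H (a i)) := by
  have : FiniteDimensional ℂ (Submodule.span ℂ (range fun i => ker H (a i))) :=
    FiniteDimensional.span_of_finite ℂ (finite_range _)
  have : CompleteSpace (zeroSubspace H (range a)) :=
    (isClosed_zeroSubspace H (range a)).completeSpace_coe
  ext f
  change (zeroSubspace H (range a)).starProjection f = 0 ↔ _
  rw [Submodule.starProjection_apply_eq_zero_iff, zeroSubspace_range,
    Submodule.orthogonal_orthogonal]

theorem Z_apply_eq_self_iff (s : Set X) (f : H) :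
    (Z H s : H →L[ℂ] H) f = f ↔ ∀ x ∈ s, f x = 0 := by
  have : CompleteSpace (zeroSubspace H s) := (isClosed_zeroSubspace H s).completeSpace_coe
  exact Submodule.starProjection_eq_self_iff

/-- The matrix is singular exactly when some nonzero combination of the kernels at the points `b`
vanishes at all the points `a`. -/
theorem kerInfRange_Z_eq_bot_iff {k : ℕ} (a b : Fin k → X)
    (hb : LinearIndependent ℂ fun i => ker H (b i)) :
    kerInfRange (Z H (range b) : H →L[ℂ] H) (Z H (range a)) = ⊥ ↔
      (Matrix.of fun i j : Fin k => ker H (b i) (a j)).det ≠ 0 := by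
  have hvm : ∀ (c : Fin k → ℂ) (j : Fin k),
      Matrix.vecMul c (Matrix.of fun i j : Fin k => ker H (b i) (a j)) j
        = (∑ i, c i • ker H (b i) : H) (a j) := by
    intro c j
    rw [← inner_ker, inner_sum]
    simp [Matrix.vecMul, dotProduct, inner_smul_right, inner_ker]
  rw [← not_iff_not, ← ne_eq, Submodule.ne_bot_iff, not_ne_iff, ← Matrix.exists_vecMul_eq_zero_iff]
  refine Iff.symm ?_
  constructor
  · rintro ⟨c, hc0, hc⟩
    refine ⟨∑ i, c i • ker H (b i), mem_kerInfRange.2 ⟨?_, ?_⟩, ?_⟩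
    · change _ ∈ LinearMap.ker ((Z H (range b) : H →L[ℂ] H) : H →ₗ[ℂ] H)
      rw [ker_Z]
      exact Submodule.sum_mem _ fun i _ => Submodule.smul_mem _ _ (Submodule.subset_span ⟨i, rfl⟩)
    · rw [Z_apply_eq_self_iff]
      rintro _ ⟨j, rfl⟩
      rw [← hvm, hc]; rfl
    · intro h0
      exact hc0 (funext (Fintype.linearIndependent_iff.1 hb c h0))
  · rintro ⟨f, hf, hf0⟩
    rw [mem_kerInfRange, Z_apply_eq_self_iff] at hf
    obtain ⟨h1, h2⟩ := hf
    change f ∈ LinearMap.ker ((Z H (range b) : H →L[ℂ] H) : H →ₗ[ℂ] H) at h1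
    rw [ker_Z] at h1
    obtain ⟨c, rfl⟩ := (Submodule.mem_span_range_iff_exists_fun ℂ).1 h1
    refine ⟨c, ?_, ?_⟩
    · rintro rfl; simp at hf0
    · funext j
      rw [hvm]; exact h2 _ ⟨j, rfl⟩

end ZeroSets

end ZeroSpaces

end Grassmann

end

theorem proposition2p2 {X : Type*} (H : Type*) [NormedAddCommGroup H] [InnerProductSpace ℂ H]
    [CompleteSpace H] [RKHS ℂ H X ℂ]
    (m k : ℕ) (a : Fin m → X) (b : Fin k → X)
    (ha : Function.Injective a) (hb : Function.Injective b)
    (hab : Disjoint (Set.range a) (Set.range b))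
    (hka : LinearIndependent ℂ (fun i => Grassmann.ker H (a i)))
    (hkb : LinearIndependent ℂ (fun i => Grassmann.ker H (b i))) :
    ((∃ γ, Grassmann.IsGeodesic γ ∧
        Grassmann.Joins γ (Grassmann.Z H (Set.range a)) (Grassmann.Z H (Set.range b))) ↔ m = k) ∧
    ((∃ γ, Grassmann.IsMinimalGeodesic γ
        (Grassmann.Z H (Set.range a)) (Grassmann.Z H (Set.range b))) ↔ m = k) ∧
    ∀ h : k = m,
      ((∃! γ, Grassmann.IsMinimalGeodesic γ
          (Grassmann.Z H (Set.range a)) (Grassmann.Z H (Set.range b))) ↔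
        (Matrix.of fun i j : Fin k => Grassmann.ker H (b i) (a (Fin.cast h j))).det ≠ 0) ∧
      ((Matrix.of fun i j : Fin k => Grassmann.ker H (b i) (a (Fin.cast h j))).det = 0 →
        {γ | Grassmann.IsMinimalGeodesic γ
          (Grassmann.Z H (Set.range a)) (Grassmann.Z H (Set.range b))}.Infinite) := by
  -- a geodesic is continuous, so it preserves the dimension of the kernel
  have hdim : (∃ γ, Grassmann.IsGeodesic γ ∧
      Grassmann.Joins γ (Grassmann.Z H (Set.range a)) (Grassmann.Z H (Set.range b))) → m = k := by
    rintro ⟨γ, hγ, hj⟩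
    have h := Grassmann.rank_ker_eq_of_joins hγ.1.isPiecewiseSmooth.1 hj
    rw [Grassmann.ker_Z, Grassmann.ker_Z] at h
    have hfin := congrArg Cardinal.toNat h
    change Module.finrank ℂ _ = Module.finrank ℂ _ at hfin
    rw [finrank_span_eq_card hka, finrank_span_eq_card hkb] at hfin
    simpa using hfin
  have hmain : ∀ h : k = m,
      ((Matrix.of fun i j : Fin k => Grassmann.ker H (b i) (a (Fin.cast h j))).det ≠ 0 →
        ∃! γ, Grassmann.IsMinimalGeodesic γ
          (Grassmann.Z H (Set.range a)) (Grassmann.Z H (Set.range b))) ∧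
      ((Matrix.of fun i j : Fin k => Grassmann.ker H (b i) (a (Fin.cast h j))).det = 0 →
        {γ | Grassmann.IsMinimalGeodesic γ
          (Grassmann.Z H (Set.range a)) (Grassmann.Z H (Set.range b))}.Infinite) := by
    rintro rfl
    simp only [Fin.cast_eq_self]
    have hPfin : FiniteDimensional ℂ
        (LinearMap.ker ((Grassmann.Z H (Set.range a) : H →L[ℂ] H) : H →ₗ[ℂ] H)) := by
      rw [Grassmann.ker_Z]; exact FiniteDimensional.span_of_finite ℂ (Set.finite_range _)
    have hQfin : FiniteDimensional ℂ
        (LinearMap.ker ((Grassmann.Z H (Set.range b) : H →L[ℂ] H) : H →ₗ[ℂ] H)) := by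
      rw [Grassmann.ker_Z]; exact FiniteDimensional.span_of_finite ℂ (Set.finite_range _)
    have hd := Grassmann.isMinimalGeodesic_dichotomy
      (P := Grassmann.Z H (Set.range a)) (Q := Grassmann.Z H (Set.range b)) (by
        rw [Grassmann.ker_Z, Grassmann.ker_Z, finrank_span_eq_card hka, finrank_span_eq_card hkb])
    have hiff := Grassmann.kerInfRange_Z_eq_bot_iff H a b hkb
    exact ⟨fun h => hd.1 (hiff.2 h), fun h => hd.2 fun h0 => hiff.1 h0 h⟩
  refine ⟨⟨hdim, fun h => ?_⟩, ⟨?_, fun h => ?_⟩, fun h => ⟨⟨fun hu hdet => ?_, (hmain h).1⟩,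
    (hmain h).2⟩⟩
  · by_cases hdet : (Matrix.of fun i j : Fin k =>
        Grassmann.ker H (b i) (a (Fin.cast h.symm j))).det = 0
    · obtain ⟨γ, hγ⟩ := ((hmain h.symm).2 hdet).nonempty
      exact ⟨γ, hγ.1, hγ.2.1⟩
    · obtain ⟨γ, hγ, -⟩ := (hmain h.symm).1 hdet
      exact ⟨γ, hγ.1, hγ.2.1⟩
  · rintro ⟨γ, hγ⟩
    exact hdim ⟨γ, hγ.1, hγ.2.1⟩
  · by_cases hdet : (Matrix.of fun i j : Fin k =>
        Grassmann.ker H (b i) (a (Fin.cast h.symm j))).det = 0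
    · exact ((hmain h.symm).2 hdet).nonempty
    · exact ((hmain h.symm).1 hdet).exists
  · obtain ⟨γ, -, hγ⟩ := hu
    exact (hmain h).2 hdet ((Set.finite_singleton γ).subset hγ)
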